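/- Let $(M,g)$ be a connected smooth Riemannian manifold of dimension $6$ with Levi-Civita connection $\nabla^g$, and let $T$ be a smooth $3$-form on $M$. Let $\nabla=\nabla^g+\frac12 T$, i.e. $g(\nabla_XY,Z)=g(\nabla^g_XY,Z)+\frac12T(X,Y,Z)$, be the metric connection with totally skew-symmetric torsion $T$. Let $dT$ be the exterior derivative and $\delta T_{ij}=-\nabla^g_sT_{sij}$ the codifferential of $T$, and define the $1$-forms $\theta_j=\delta T_{ab}\,T_{jab}$ and $\Theta_j=T_{abc}\,dT_{jabc}$ (indices refer to a local orthonormal frame, repeated indices are summed). Let $Ric(X,Y)=\sum_i g(R(e_i,X)Y,e_i)$, where $R(X,Y)=[\nabla_X,\nabla_Y]-\nabla_{[X,Y]}$, be the Ricci tensor of $\nabla$, and call $\nabla$ $\nabla$-Einstein if there is a function $\lambda$ on $M$ with $\frac12\big(Ric(X,Y)+Ric(Y,X)\big)=\lambda\, g(X,Y)$ for all $X,Y$. If $3\theta+\Theta=0$ on $M$ and $\nabla$ is $\nabla$-Einstein, then the Riemannian scalar curvature $Scal^g$ (the scalar curvature of $\nabla^g$) is constant. The condition $3\theta+\Theta=0$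 holds in particular if $T$ is harmonic, i.e. $dT=0$ and $\delta T=0$. -/

import Mathlib

open Bundle FiberBundle VectorField
open scoped Manifold ContDiff Topology

namespace TorsionGeometry

noncomputable section

set_option linter.unusedSectionVars false

variable {E : Type*} [NormedAddCommGroup E] [NormedSpace ℝ E] [FiniteDimensional ℝ E]
  {H : Type*} [TopologicalSpace H] (I : ModelWithCorners ℝ E H)
  {M : Type*} [TopologicalSpace M] [ChartedSpace H M]

instance tangentSpaceFiniteDimensional (x : M) : FiniteDimensional ℝ (TangentSpace I x) :=
  inferInstanceAs (FiniteDimensional ℝ E)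

variable [RiemannianBundle (fun x : M ↦ TangentSpace I x)]

/-- Right-hand side of the Koszul formula, `2 ⟨∇_X Y, Z⟩` at the point `x`. -/
def koszul (X Y Z : Π x : M, TangentSpace I x) (x : M) : ℝ :=
  d% (fun y ↦ inner ℝ (Y y) (Z y)) x (X x) + d% (fun y ↦ inner ℝ (Z y) (X y)) x (Y x)
    - d% (fun y ↦ inner ℝ (X y) (Y y)) x (Z x)
    + inner ℝ (mlieBracket I X Y x) (Z x) - inner ℝ (mlieBracket I Y Z x) (X x)
    + inner ℝ (mlieBracket I Z X x) (Y x)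

variable [IsManifold I ∞ M] [IsContMDiffRiemannianBundle I ∞ E (fun x : M ↦ TangentSpace I x)]

variable {I} in
theorem mdiff_inner {X Y : Π x : M, TangentSpace I x} {x : M} (hX : MDiffAt (T% X) x)
    (hY : MDiffAt (T% Y) x) : MDiffAt (fun y ↦ inner ℝ (X y) (Y y)) x :=
  MDifferentiableAt.inner_bundle (E := fun x : M ↦ TangentSpace I x) (F := E) hX hY

theorem koszul_tensorial_left (Y Z : Π x : M, TangentSpace I x) {x : M}
    (hY : MDiffAt (T% Y) x) (hZ : MDiffAt (T% Z) x) :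
    TensorialAt I E (fun X ↦ koszul I X Y Z x) x where
  smul {f X} hf hX := by
    have h1 := mvfderiv_mul hf (mdiff_inner hZ hX)
    have h2 := mvfderiv_mul hf (mdiff_inner hX hY)
    have e1 : (fun y ↦ inner ℝ (Z y) ((f • X) y)) = f * fun y ↦ inner ℝ (Z y) (X y) := by
      ext y; simp [inner_smul_right]
    have e2 : (fun y ↦ inner ℝ ((f • X) y) (Y y)) = f * fun y ↦ inner ℝ (X y) (Y y) := by
      ext y; simp [inner_smul_left]
    rw [koszul, e1, e2, h1, h2, mlieBracket_smul_left hf hX, mlieBracket_smul_right hf hX]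
    simp [koszul, inner_smul_left, inner_smul_right, inner_add_left]
    rw [real_inner_comm (X x) (Z x)]
    ring
  add {X X'} hX hX' := by
    have h1 := mvfderiv_add (mdiff_inner hZ hX) (mdiff_inner hZ hX')
    have h2 := mvfderiv_add (mdiff_inner hX hY) (mdiff_inner hX' hY)
    have e1 : (fun y ↦ inner ℝ (Z y) ((X + X') y)) =
      (fun y ↦ inner ℝ (Z y) (X y)) + fun y ↦ inner ℝ (Z y) (X' y) := by
      ext y; simp [inner_add_right]
    have e2 : (fun y ↦ inner ℝ ((X + X') y) (Y y)) =
      (fun y ↦ inner ℝ (X y) (Y y)) + fun y ↦ inner ℝ (X' y) (Y y) := by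
      ext y; simp [inner_add_left]
    rw [koszul, e1, e2, h1, h2, mlieBracket_add_left hX hX', mlieBracket_add_right hX hX']
    simp [koszul, inner_add_left, inner_add_right]
    ring

theorem koszul_tensorial_right (X Y : Π x : M, TangentSpace I x) {x : M}
    (hX : MDiffAt (T% X) x) (hY : MDiffAt (T% Y) x) :
    TensorialAt I E (fun Z ↦ koszul I X Y Z x) x where
  smul {f Z} hf hZ := by
    have h1 := mvfderiv_mul hf (mdiff_inner hY hZ)
    have h2 := mvfderiv_mul hf (mdiff_inner hZ hX)
    have e1 : (fun y ↦ inner ℝ (Y y) ((f • Z) y)) = f * fun y ↦ inner ℝ (Y y) (Z y) := by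
      ext y; simp [inner_smul_right]
    have e2 : (fun y ↦ inner ℝ ((f • Z) y) (X y)) = f * fun y ↦ inner ℝ (Z y) (X y) := by
      ext y; simp [inner_smul_left]
    rw [koszul, e1, e2, h1, h2, mlieBracket_smul_left hf hZ, mlieBracket_smul_right hf hZ]
    simp [koszul, inner_smul_left, inner_smul_right, inner_add_left]
    rw [real_inner_comm (Y x) (Z x)]
    ring
  add {Z Z'} hZ hZ' := by
    have h1 := mvfderiv_add (mdiff_inner hY hZ) (mdiff_inner hY hZ')
    have h2 := mvfderiv_add (mdiff_inner hZ hX) (mdiff_inner hZ' hX)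
    have e1 : (fun y ↦ inner ℝ (Y y) ((Z + Z') y)) =
      (fun y ↦ inner ℝ (Y y) (Z y)) + fun y ↦ inner ℝ (Y y) (Z' y) := by
      ext y; simp [inner_add_right]
    have e2 : (fun y ↦ inner ℝ ((Z + Z') y) (X y)) =
      (fun y ↦ inner ℝ (Z y) (X y)) + fun y ↦ inner ℝ (Z' y) (X y) := by
      ext y; simp [inner_add_left]
    rw [koszul, e1, e2, h1, h2, mlieBracket_add_left hZ hZ', mlieBracket_add_right hZ hZ']
    simp [koszul, inner_add_left, inner_add_right]
    ring

theorem koszul_add {X Y Y' Z : Π x : M, TangentSpace I x} {x : M} (hX : MDiffAt (T% X) x)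
    (hY : MDiffAt (T% Y) x) (hY' : MDiffAt (T% Y') x) (hZ : MDiffAt (T% Z) x) :
    koszul I X (Y + Y') Z x = koszul I X Y Z x + koszul I X Y' Z x := by
  have h1 := mvfderiv_add (mdiff_inner hY hZ) (mdiff_inner hY' hZ)
  have h2 := mvfderiv_add (mdiff_inner hX hY) (mdiff_inner hX hY')
  have e1 : (fun y ↦ inner ℝ ((Y + Y') y) (Z y)) =
    (fun y ↦ inner ℝ (Y y) (Z y)) + fun y ↦ inner ℝ (Y' y) (Z y) := by
    ext y; simp [inner_add_left]
  have e2 : (fun y ↦ inner ℝ (X y) ((Y + Y') y)) =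
    (fun y ↦ inner ℝ (X y) (Y y)) + fun y ↦ inner ℝ (X y) (Y' y) := by
    ext y; simp [inner_add_right]
  rw [koszul, e1, e2, h1, h2, mlieBracket_add_left hY hY', mlieBracket_add_right hY hY']
  simp [koszul, inner_add_left, inner_add_right]
  ring

theorem koszul_leibniz {X Y Z : Π x : M, TangentSpace I x} {f : M → ℝ} {x : M}
    (hX : MDiffAt (T% X) x) (hY : MDiffAt (T% Y) x) (hZ : MDiffAt (T% Z) x) (hf : MDiffAt f x) :
    koszul I X (f • Y) Z x =
      f x * koszul I X Y Z x + 2 * (d% f x (X x) * inner ℝ (Y x) (Z x)) := by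
  have h1 := mvfderiv_mul hf (mdiff_inner hY hZ)
  have h2 := mvfderiv_mul hf (mdiff_inner hX hY)
  have e1 : (fun y ↦ inner ℝ ((f • Y) y) (Z y)) = f * fun y ↦ inner ℝ (Y y) (Z y) := by
    ext y; simp [inner_smul_left]
  have e2 : (fun y ↦ inner ℝ (X y) ((f • Y) y)) = f * fun y ↦ inner ℝ (X y) (Y y) := by
    ext y; simp [inner_smul_right]
  rw [koszul, e1, e2, h1, h2, mlieBracket_smul_left hf hY, mlieBracket_smul_right hf hY]
  simp [koszul, inner_smul_left, inner_smul_right, inner_add_left]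
  rw [real_inner_comm (X x) (Y x)]
  ring

open Classical in
/-- The Levi-Civita connection as an operator on vector fields: `∇_v Y` is the vector with
`2 ⟨∇_v Y, Z⟩ = koszul v Y Z` for all `Z` (and `0` if `Y` is not differentiable at `x`). -/
def leviCivitaFun (Y : Π x : M, TangentSpace I x) (x : M) :
    TangentSpace I x →L[ℝ] TangentSpace I x :=
  if hY : MDiffAt (T% Y) x then
    letI K := TensorialAt.mkHom₂ (fun X Z ↦ koszul I X Y Z x) x
        (fun Z hZ ↦ koszul_tensorial_left I Y Z hY hZ)
        (fun X hX ↦ koszul_tensorial_right I X Y hX hY)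
    LinearMap.toContinuousLinearMap
      { toFun := fun v ↦ (InnerProductSpace.toDual ℝ (TangentSpace I x)).symm ((1 / 2 : ℝ) • K v)
        map_add' := fun v w ↦ by simp
        map_smul' := fun c v ↦ by
          simp only [map_smul, RingHom.id_apply, smul_comm c (1 / 2 : ℝ)] }
  else 0

theorem inner_leviCivitaFun {X Y Z : Π x : M, TangentSpace I x} {x : M}
    (hX : MDiffAt (T% X) x) (hY : MDiffAt (T% Y) x) (hZ : MDiffAt (T% Z) x) :
    inner ℝ (leviCivitaFun I Y x (X x)) (Z x) = 1 / 2 * koszul I X Y Z x := by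
  rw [leviCivitaFun, dif_pos hY]
  simp only [LinearMap.coe_toContinuousLinearMap', LinearMap.coe_mk, AddHom.coe_mk,
    InnerProductSpace.toDual_symm_apply]
  have := TensorialAt.mkHom₂_apply (F := E) (F' := E) (Φ := fun X Z ↦ koszul I X Y Z x) (x := x)
        (fun Z hZ ↦ koszul_tensorial_left I Y Z hY hZ)
        (fun X hX ↦ koszul_tensorial_right I X Y hX hY) hX hZ
  simp [this]

theorem isCovariantDerivativeOn_leviCivitaFun :
    IsCovariantDerivativeOn E (leviCivitaFun I (M := M)) Set.univ where
  add {Y Y' x} hY hY' _ := by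
    ext v
    refine ext_inner_right ℝ fun w ↦ ?_
    have hv := mdifferentiableAt_extend I E v
    have hw := mdifferentiableAt_extend I E w
    have a1 := inner_leviCivitaFun I hv (mdifferentiableAt_add_section hY hY') hw
    have a2 := inner_leviCivitaFun I hv hY hw
    have a3 := inner_leviCivitaFun I hv hY' hw
    simp only [extend_apply_self] at a1 a2 a3
    rw [_root_.add_apply, inner_add_left, a2, a3]
    refine a1.trans ?_
    rw [koszul_add I hv hY hY' hw]
    ring
  leibniz {Y f x} hY hf _ := by
    ext v
    refine ext_inner_right ℝ fun w ↦ ?_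
    have hv := mdifferentiableAt_extend I E v
    have hw := mdifferentiableAt_extend I E w
    have a1 := inner_leviCivitaFun I hv (hf.smul_section hY) hw
    have a2 := inner_leviCivitaFun I hv hY hw
    simp only [extend_apply_self] at a1 a2
    refine a1.trans ?_
    rw [koszul_leibniz I hv hY hw hf]
    simp [inner_add_left, inner_smul_left, a2]
    ring

/-- The Levi-Civita connection of the Riemannian metric. -/
def leviCivita : CovariantDerivative I E (fun x : M ↦ TangentSpace I x) :=
  ⟨leviCivitaFun I, isCovariantDerivativeOn_leviCivitaFun I⟩

theorem leviCivita_torsion : (leviCivita I (M := M)).torsion = 0 := by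
  rw [CovariantDerivative.torsion_eq_zero_iff]
  intro X Y x hX hY
  refine ext_inner_right ℝ fun w ↦ ?_
  have hw := mdifferentiableAt_extend I E w
  have a1 := inner_leviCivitaFun I hX hY hw
  have a2 := inner_leviCivitaFun I hY hX hw
  simp only [extend_apply_self] at a1 a2
  simp only [leviCivita]
  rw [inner_sub_left, a1, a2]
  simp only [koszul, extend_apply_self]
  rw [mlieBracket_swap_apply (V := extend E w) (W := X),
   mlieBracket_swap_apply (V := extend E w) (W := Y), mlieBracket_swap_apply (V := Y) (W := X)]
  simp only [inner_neg_left, real_inner_comm]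
  ring

theorem leviCivita_metric {X Y Z : Π x : M, TangentSpace I x} {x : M}
    (hX : MDiffAt (T% X) x) (hY : MDiffAt (T% Y) x) (hZ : MDiffAt (T% Z) x) :
    d% (fun y ↦ inner ℝ (Y y) (Z y)) x (X x) = inner ℝ (leviCivita I Y x (X x)) (Z x)
      + inner ℝ (Y x) (leviCivita I Z x (X x)) := by
  rw [real_inner_comm _ (Y x)]
  have a1 := inner_leviCivitaFun I hX hY hZ
  have a2 := inner_leviCivitaFun I hX hZ hY
  simp only [leviCivita]
  rw [a1, a2]
  simp only [koszul]
  rw [mlieBracket_swap_apply (V := Z) (W := Y),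
   mlieBracket_swap_apply (V := X) (W := Y), mlieBracket_swap_apply (V := Z) (W := X)]
  simp only [inner_neg_left, real_inner_comm]
  ring

theorem leviCivita_isMetricCompatible :
    (leviCivita I (M := M)).IsMetricCompatible (V := fun x : M ↦ TangentSpace I x) := by
  rw [CovariantDerivative.isMetricCompatible_iff]
  intro x X Y Z hX hY hZ
  exact leviCivita_metric I hX hY hZ

/-! ### Differential 3-forms -/

/-- Smoothness of a 3-form: its values on smooth vector fields are smooth functions. -/
def IsSmoothForm (T : Π x : M, TangentSpace I x [⋀^Fin 3]→L[ℝ] ℝ) : Prop :=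
  ∀ (x : M) (X : Fin 3 → Π y : M, TangentSpace I y), (∀ i, CMDiffAt ∞ (T% (X i)) x) →
    CMDiffAt ∞ (fun y ↦ T y (fun i ↦ X i y)) x

/-- The exterior derivative of a 3-form on vector fields, by Cartan's invariant formula. -/
def extDerivOnFields (T : Π x : M, TangentSpace I x [⋀^Fin 3]→L[ℝ] ℝ)
    (X Y Z V : Π x : M, TangentSpace I x) (x : M) : ℝ :=
  d% (fun y ↦ T y ![Y y, Z y, V y]) x (X x) - d% (fun y ↦ T y ![X y, Z y, V y]) x (Y x)
    + d% (fun y ↦ T y ![X y, Y y, V y]) x (Z x) - d% (fun y ↦ T y ![X y, Y y, Z y]) x (V x)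
    - T x ![mlieBracket I X Y x, Z x, V x] + T x ![mlieBracket I X Z x, Y x, V x]
    - T x ![mlieBracket I X V x, Y x, Z x] - T x ![mlieBracket I Y Z x, X x, V x]
    + T x ![mlieBracket I Y V x, X x, Z x] - T x ![mlieBracket I Z V x, X x, Y x]

/-- The exterior derivative `dT` at `x` on tangent vectors, which are extended to vector fields
near `x` (the value does not depend on the extension). -/
def extDeriv (T : Π x : M, TangentSpace I x [⋀^Fin 3]→L[ℝ] ℝ) (x : M)
    (u v w z : TangentSpace I x) : ℝ :=
  extDerivOnFields I T (extend E u) (extend E v) (extend E w) (extend E z) x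

/-- The covariant derivative `(D_u T)(v₀, v₁, v₂)` of a 3-form. -/
def covDerivForm (D : CovariantDerivative I E (fun x : M ↦ TangentSpace I x))
    (T : Π x : M, TangentSpace I x [⋀^Fin 3]→L[ℝ] ℝ) (x : M) (u : TangentSpace I x)
    (v : Fin 3 → TangentSpace I x) : ℝ :=
  d% (fun y ↦ T y (fun i ↦ extend E (v i) y)) x u
    - ∑ i, T x (Function.update v i (D (extend E (v i)) x u))

/-- An orthonormal basis of the tangent space at `x`. -/
def frame (x : M) :
    OrthonormalBasis (Fin (Module.finrank ℝ (TangentSpace I x))) ℝ (TangentSpace I x) :=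
  stdOrthonormalBasis ℝ (TangentSpace I x)

/-- The codifferential `(δT)(u, v) = - ∑ᵢ (∇^g_{eᵢ} T)(eᵢ, u, v)`. -/
def codiff (T : Π x : M, TangentSpace I x [⋀^Fin 3]→L[ℝ] ℝ) (x : M) (u v : TangentSpace I x) : ℝ :=
  - ∑ i, covDerivForm I (leviCivita I) T x (frame I x i) ![frame I x i, u, v]

/-- `T` is harmonic: `dT = 0` and `δT = 0`. -/
def IsHarmonic (T : Π x : M, TangentSpace I x [⋀^Fin 3]→L[ℝ] ℝ) : Prop :=
  (∀ (x : M) (u v w z : TangentSpace I x), extDeriv I T x u v w z = 0) ∧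
    ∀ (x : M) (u v : TangentSpace I x), codiff I T x u v = 0

/-- The torsion 1-form `θ_j = (δT)_{ab} T_{jab}`. -/
def theta (T : Π x : M, TangentSpace I x [⋀^Fin 3]→L[ℝ] ℝ) (x : M) (u : TangentSpace I x) : ℝ :=
  ∑ a, ∑ b, codiff I T x (frame I x a) (frame I x b) * T x ![u, frame I x a, frame I x b]

/-- The torsion 1-form `Θ_j = T_{abc} (dT)_{jabc}`. -/
def bigTheta (T : Π x : M, TangentSpace I x [⋀^Fin 3]→L[ℝ] ℝ) (x : M) (u : TangentSpace I x) : ℝ :=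
  ∑ a, ∑ b, ∑ c, T x ![frame I x a, frame I x b, frame I x c] *
    extDeriv I T x u (frame I x a) (frame I x b) (frame I x c)

/-! ### The torsion connection -/

/-- The vector-valued form of a 3-form: `⟨T(u, v), w⟩ = T(u, v, w)`. -/
def sharp (T : Π x : M, TangentSpace I x [⋀^Fin 3]→L[ℝ] ℝ) (x : M) (u v : TangentSpace I x) :
    TangentSpace I x :=
  ∑ i, T x ![u, v, frame I x i] • frame I x i

variable {I} in
theorem inner_sharp (T : Π x : M, TangentSpace I x [⋀^Fin 3]→L[ℝ] ℝ) (x : M)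
    (u v w : TangentSpace I x) : inner ℝ (sharp I T x u v) w = T x ![u, v, w] := by
  have key : ∀ z, T x ![u, v, z] =
      ((T x).toContinuousMultilinearMap.toContinuousLinearMap ![u, v, 0] 2) z := by
    intro z
    simp only [ContinuousMultilinearMap.toContinuousLinearMap_apply,
      ContinuousAlternatingMap.coe_toContinuousMultilinearMap]
    congr 1
    ext i
    fin_cases i <;> simp
  conv_rhs => rw [← (frame I x).sum_repr' w, key, map_sum]
  refine (sum_inner _ _ _).trans (Finset.sum_congr rfl fun i _ ↦ ?_)
  rw [map_smul, ← key, inner_smul_left, smul_eq_mul, conj_trivial, mul_comm]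

theorem sharp_add_left (T : Π x : M, TangentSpace I x [⋀^Fin 3]→L[ℝ] ℝ) (x : M)
    (u u' v : TangentSpace I x) :
    sharp I T x (u + u') v = sharp I T x u v + sharp I T x u' v := by
  refine ext_inner_right ℝ fun w ↦ ?_
  simp only [inner_add_left, inner_sharp]
  exact (T x).toAlternatingMap.map_vecCons_add ![v, w] u u'

theorem sharp_smul_left (T : Π x : M, TangentSpace I x [⋀^Fin 3]→L[ℝ] ℝ) (x : M) (c : ℝ)
    (u v : TangentSpace I x) : sharp I T x (c • u) v = c • sharp I T x u v := by
  refine ext_inner_right ℝ fun w ↦ ?_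
  simp only [inner_smul_left, inner_sharp]
  exact (T x).toAlternatingMap.map_vecCons_smul ![v, w] c u

theorem sharp_swap (T : Π x : M, TangentSpace I x [⋀^Fin 3]→L[ℝ] ℝ) (x : M)
    (u v : TangentSpace I x) : sharp I T x u v = - sharp I T x v u := by
  refine ext_inner_right ℝ fun w ↦ ?_
  rw [inner_neg_left, inner_sharp, inner_sharp]
  have := (T x).toAlternatingMap.map_swap ![v, u, w] (i := 0) (j := 1) (by decide)
  rw [ContinuousAlternatingMap.coe_toAlternatingMap] at this
  rw [← this]
  congr 1
  ext i
  fin_cases i <;> simp [Equiv.swap_apply_def]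

/-- The torsion connection `∇_X Y = ∇^g_X Y + (1 / 2) T(X, Y)`, i.e. the metric connection with
skew-symmetric torsion `T`. -/
def torsionConnection (T : Π x : M, TangentSpace I x [⋀^Fin 3]→L[ℝ] ℝ) :
    CovariantDerivative I E (fun x : M ↦ TangentSpace I x) :=
  (leviCivita I).addOneForm fun x ↦ LinearMap.toContinuousBilinearMap
    (LinearMap.mk₂ ℝ (fun v u : TangentSpace I x ↦ (1 / 2 : ℝ) • sharp I T x u v)
      (fun v v' u ↦ by
        rw [sharp_swap, sharp_add_left, sharp_swap I T x u v, sharp_swap I T x u v']; module)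
      (fun c v u ↦ by
        rw [sharp_swap, sharp_smul_left, sharp_swap I T x u v]; module)
      (fun v u u' ↦ by rw [sharp_add_left, smul_add])
      (fun c v u ↦ by rw [sharp_smul_left, smul_comm]))

theorem torsionConnection_apply (T : Π x : M, TangentSpace I x [⋀^Fin 3]→L[ℝ] ℝ)
    (Y : Π x : M, TangentSpace I x) (x : M) (u : TangentSpace I x) :
    torsionConnection I T Y x u = leviCivita I Y x u + (1 / 2 : ℝ) • sharp I T x u (Y x) := rfl

theorem torsionConnection_isMetricCompatible
    (T : Π x : M, TangentSpace I x [⋀^Fin 3]→L[ℝ] ℝ) :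
    (torsionConnection I T).IsMetricCompatible (V := fun x : M ↦ TangentSpace I x) := by
  rw [CovariantDerivative.isMetricCompatible_iff]
  intro x X Y Z hX hY hZ
  simp only
  rw [leviCivita_metric I hX hY hZ, torsionConnection_apply, torsionConnection_apply,
    inner_add_left, inner_add_right, inner_smul_left, inner_smul_right,
    real_inner_comm _ (Y x), real_inner_comm _ (Y x), inner_sharp, inner_sharp]
  have := (T x).toAlternatingMap.map_swap ![X x, Y x, Z x] (i := 1) (j := 2) (by decide)
  rw [ContinuousAlternatingMap.coe_toAlternatingMap] at this
  have e : ![X x, Y x, Z x] ∘ Equiv.swap (1 : Fin 3) 2 = ![X x, Z x, Y x] := by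
    ext i
    fin_cases i <;> simp [Equiv.swap_apply_def]
  rw [e] at this
  rw [this, conj_trivial]
  ring

theorem torsionConnection_torsion (T : Π x : M, TangentSpace I x [⋀^Fin 3]→L[ℝ] ℝ) (x : M)
    (u v w : TangentSpace I x) :
    inner ℝ ((torsionConnection I T).torsion x u v) w = T x ![u, v, w] := by
  have h := congr($(leviCivita_torsion I (M := M)) x u v)
  rw [CovariantDerivative.torsion_apply_eq_extend] at h
  rw [CovariantDerivative.torsion_apply_eq_extend, ← inner_sharp]
  congr 1
  rw [torsionConnection_apply, torsionConnection_apply]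
  simp only [extend_apply_self] at h ⊢
  rw [sharp_swap I T x v u]
  replace h := h.trans (show _ = (0 : TangentSpace I x) from rfl)
  rw [← sub_eq_zero, ← h]
  module

/-! ### Curvature -/

/-- The curvature `R(X, Y)Z = D_X D_Y Z - D_Y D_X Z - D_{[X, Y]} Z` on vector fields. -/
def curvatureOnFields (D : CovariantDerivative I E (fun x : M ↦ TangentSpace I x))
    (X Y Z : Π x : M, TangentSpace I x) (x : M) : TangentSpace I x :=
  D (fun y ↦ D Z y (Y y)) x (X x) - D (fun y ↦ D Z y (X y)) x (Y x) - D Z x (mlieBracket I X Y x)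

/-- The curvature tensor `R(u, v)w` at `x`; the tangent vectors are extended to vector fields near
`x` (the value does not depend on the extension). -/
def curvature (D : CovariantDerivative I E (fun x : M ↦ TangentSpace I x)) (x : M)
    (u v w : TangentSpace I x) : TangentSpace I x :=
  curvatureOnFields I D (extend E u) (extend E v) (extend E w) x

/-- The Ricci tensor `Ric(u, v) = ∑ᵢ ⟨R(eᵢ, u)v, eᵢ⟩`. -/
def ricci (D : CovariantDerivative I E (fun x : M ↦ TangentSpace I x)) (x : M)
    (u v : TangentSpace I x) : ℝ :=
  ∑ i, inner ℝ (curvature I D x (frame I x i) u v) (frame I x i)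

/-- The scalar curvature `∑ᵢ Ric(eᵢ, eᵢ)`. -/
def scalarCurvature (D : CovariantDerivative I E (fun x : M ↦ TangentSpace I x)) (x : M) : ℝ :=
  ∑ i, ricci I D x (frame I x i) (frame I x i)

/-- The `∇`-Einstein condition: the symmetric part of the Ricci tensor is a scalar multiple of the
metric, the factor being a function on `M`. -/
def IsNablaEinstein (D : CovariantDerivative I E (fun x : M ↦ TangentSpace I x)) : Prop :=
  ∃ f : M → ℝ, ∀ (x : M) (u v : TangentSpace I x),
    (ricci I D x u v + ricci I D x v u) / 2 = f x * inner ℝ u v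

end

end TorsionGeometry

open Bundle FiberBundle VectorField
open scoped Manifold ContDiff Topology

namespace TorsionGeometry

noncomputable section

set_option linter.unusedSectionVars false

variable {E : Type*} [NormedAddCommGroup E] [NormedSpace ℝ E] [FiniteDimensional ℝ E]
  {H : Type*} [TopologicalSpace H] {I : ModelWithCorners ℝ E H}
  {M : Type*} [TopologicalSpace M] [ChartedSpace H M]
variable [RiemannianBundle (fun x : M ↦ TangentSpace I x)]
variable [IsManifold I ∞ M] [IsContMDiffRiemannianBundle I ∞ E (fun x : M ↦ TangentSpace I x)]

/-! ### Smooth functions and vector fields on a set -/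

variable (I) in
/-- The function `f` is smooth at every point of `U`. -/
def SmoothFun (U : Set M) (f : M → ℝ) : Prop := ∀ y ∈ U, CMDiffAt ∞ f y

/-- The vector field `X` is smooth at every point of `U`. -/
def SmoothField (U : Set M) (X : Π x : M, TangentSpace I x) : Prop := ∀ y ∈ U, CMDiffAt ∞ (T% X) y

variable {U V : Set M} {f g : M → ℝ} {X Y Z : Π x : M, TangentSpace I x} {x y : M}

namespace SmoothFun

theorem mdiff (hf : SmoothFun I U f) (hy : y ∈ U) : MDiffAt f y :=
  (hf y hy).mdifferentiableAt (by simp)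

theorem congr (hU : IsOpen U) (hf : SmoothFun I U f) (h : ∀ y ∈ U, g y = f y) :
    SmoothFun I U g := fun y hy ↦
  (hf y hy).congr_of_eventuallyEq (Filter.eventually_of_mem (hU.mem_nhds hy) h)

theorem const (c : ℝ) : SmoothFun I U (fun _ : M ↦ c) := fun _ _ ↦ contMDiffAt_const

theorem add (hf : SmoothFun I U f) (hg : SmoothFun I U g) : SmoothFun I U (fun y ↦ f y + g y) :=
  fun y hy ↦ (hf y hy).add (hg y hy)

theorem sub (hf : SmoothFun I U f) (hg : SmoothFun I U g) : SmoothFun I U (fun y ↦ f y - g y) :=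
  fun y hy ↦ (hf y hy).sub (hg y hy)

theorem mul (hf : SmoothFun I U f) (hg : SmoothFun I U g) : SmoothFun I U (fun y ↦ f y * g y) :=
  fun y hy ↦ (hf y hy).mul (hg y hy)

theorem sum {ι : Type*} {s : Finset ι} {f : ι → M → ℝ} (hf : ∀ i ∈ s, SmoothFun I U (f i)) :
    SmoothFun I U (fun y ↦ ∑ i ∈ s, f i y) := fun y hy ↦ by
  classical
  induction s using Finset.induction_on with
  | empty => simpa using contMDiffAt_const
  | insert a s ha h =>
    simp only [Finset.mem_insert, forall_eq_or_imp] at hf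
    simp only [Finset.sum_insert ha]
    exact (hf.1 y hy).add (h hf.2)

end SmoothFun

theorem mvfderiv_congr (hU : IsOpen U) (h : ∀ y ∈ U, f y = g y) (hy : y ∈ U) :
    mvfderiv I f y = mvfderiv I g y := by
  have h' : f =ᶠ[𝓝 y] g := Filter.eventually_of_mem (hU.mem_nhds hy) h
  ext v
  simp only [mvfderiv, ContinuousLinearMap.comp_apply]
  rw [h'.mfderiv_eq]
  rfl

theorem mvfderiv_add_apply (hf : MDiffAt f y) (hg : MDiffAt g y) (v : TangentSpace I y) :
    mvfderiv I (fun z ↦ f z + g z) y v = mvfderiv I f y v + mvfderiv I g y v := by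
  rw [mvfderiv_fun_add hf hg]; rfl

theorem mvfderiv_sub_apply (hf : MDiffAt f y) (hg : MDiffAt g y) (v : TangentSpace I y) :
    mvfderiv I (fun z ↦ f z - g z) y v = mvfderiv I f y v - mvfderiv I g y v := by
  rw [mvfderiv_fun_sub hf hg]; rfl

theorem mvfderiv_neg_apply (v : TangentSpace I y) :
    mvfderiv I (fun z ↦ - f z) y v = - mvfderiv I f y v := by
  rw [mvfderiv_fun_neg]; rfl

theorem mvfderiv_mul_apply (hf : MDiffAt f y) (hg : MDiffAt g y) (v : TangentSpace I y) :
    mvfderiv I (fun z ↦ f z * g z) y v = f y * mvfderiv I g y v + g y * mvfderiv I f y v := by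
  rw [mvfderiv_fun_mul hf hg]; rfl

theorem mvfderiv_const_mul_apply (c : ℝ) (hf : MDiffAt f y) (v : TangentSpace I y) :
    mvfderiv I (fun z ↦ c * f z) y v = c * mvfderiv I f y v := by
  rw [mvfderiv_mul_apply mdifferentiableAt_const hf, mvfderiv_const]
  simp

theorem mvfderiv_sum {ι : Type*} {s : Finset ι} {f : ι → M → ℝ} (hf : ∀ i ∈ s, MDiffAt (f i) y)
    (v : TangentSpace I y) :
    mvfderiv I (fun y ↦ ∑ i ∈ s, f i y) y v = ∑ i ∈ s, mvfderiv I (f i) y v := by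
  classical
  have key : MDiffAt (fun y ↦ ∑ i ∈ s, f i y) y ∧
      mvfderiv I (fun y ↦ ∑ i ∈ s, f i y) y v = ∑ i ∈ s, mvfderiv I (f i) y v := by
    induction s using Finset.induction_on with
    | empty => exact ⟨by simpa using mdifferentiableAt_const, by simp [mvfderiv_const]⟩
    | insert a s ha h =>
      simp only [Finset.mem_insert, forall_eq_or_imp] at hf
      simp only [Finset.sum_insert ha]
      refine ⟨hf.1.add (h hf.2).1, ?_⟩
      rw [← (h hf.2).2, mvfderiv_fun_add hf.1 (h hf.2).1]
      rfl
  exact key.2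

namespace SmoothField

theorem mono (hX : SmoothField V X) (h : U ⊆ V) : SmoothField U X := fun y hy ↦ hX y (h hy)

theorem mdiff (hX : SmoothField U X) (hy : y ∈ U) : MDiffAt (T% X) y :=
  (hX y hy).mdifferentiableAt (by simp)

theorem congr (hU : IsOpen U) (hX : SmoothField U X) (h : ∀ y ∈ U, Y y = X y) :
    SmoothField U Y := fun y hy ↦
  (hX y hy).congr_of_eventuallyEq
    (Filter.eventually_of_mem (hU.mem_nhds hy) fun z hz ↦ by simp [h z hz])

theorem add (hX : SmoothField U X) (hY : SmoothField U Y) : SmoothField U (X + Y) :=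
  fun y hy ↦ (hX y hy).add_section (hY y hy)

theorem sub (hX : SmoothField U X) (hY : SmoothField U Y) : SmoothField U (X - Y) :=
  fun y hy ↦ (hX y hy).sub_section (hY y hy)

theorem smul (hf : SmoothFun I U f) (hX : SmoothField U X) : SmoothField U (f • X) :=
  fun y hy ↦ (hf y hy).smul_section (hX y hy)

theorem sum {ι : Type*} {s : Finset ι} {X : ι → Π x : M, TangentSpace I x}
    (hX : ∀ i ∈ s, SmoothField U (X i)) : SmoothField U (fun y ↦ ∑ i ∈ s, X i y) :=
  fun y hy ↦ .sum_section fun i hi ↦ hX i hi y hy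

theorem inner (hX : SmoothField U X) (hY : SmoothField U Y) :
    SmoothFun I U (fun y ↦ Inner.inner ℝ (X y) (Y y)) :=
  fun y hy ↦ ContMDiffAt.inner_bundle (E := fun x : M ↦ TangentSpace I x) (F := E)
    (hX y hy) (hY y hy)

theorem bracket (hX : SmoothField U X) (hY : SmoothField U Y) :
    SmoothField U (mlieBracket I X Y) := by
  intro y hy
  have : IsManifold I ((⊤ : ℕ∞) + 1) M := ‹IsManifold I ∞ M›
  have : IsManifold I (minSmoothness ℝ 2) M := by
    rw [minSmoothness_of_isRCLikeNormedField]; infer_instance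
  exact ContMDiffAt.mlieBracket_vectorField (m := ⊤) (n := ⊤) (hX y hy) (hY y hy)
    (by rw [minSmoothness_of_isRCLikeNormedField]; exact le_rfl)

end SmoothField

theorem smoothField_extend (v : TangentSpace I x) :
    SmoothField (trivializationAt E (TangentSpace I) x).baseSet (extend E v) := by
  set t := trivializationAt E (TangentSpace I) x
  intro y hy
  rw [t.contMDiffAt_section_iff hy]
  have : CMDiffAt ∞ (fun _ : M ↦ (t ⟨x, v⟩).2) y := contMDiffAt_const
  refine this.congr_of_eventuallyEq ?_
  filter_upwards [t.open_baseSet.mem_nhds hy] with z hz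
  change (t ⟨z, t.symm z (t ⟨x, v⟩).2⟩).2 = _
  rw [t.apply_mk_symm hz]

theorem jacobi_mlieBracket (hX : SmoothField U X) (hY : SmoothField U Y) (hZ : SmoothField U Z)
    (hy : y ∈ U) :
    mlieBracket I X (mlieBracket I Y Z) y =
      mlieBracket I (mlieBracket I X Y) Z y + mlieBracket I Y (mlieBracket I X Z) y := by
  have : IsManifold I (minSmoothness ℝ 3) M := by
    rw [minSmoothness_of_isRCLikeNormedField]; infer_instance
  have h : (minSmoothness ℝ 2 : WithTop ℕ∞) ≤ ∞ := by
    rw [minSmoothness_of_isRCLikeNormedField]; exact ENat.LEInfty.out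
  exact leibniz_identity_mlieBracket_apply ((hX y hy).of_le h) ((hY y hy).of_le h)
    ((hZ y hy).of_le h)

theorem mlieBracket_congr_of_eqOn (hU : IsOpen U) {X' Y' : Π x : M, TangentSpace I x}
    (hX : ∀ y ∈ U, X y = X' y) (hY : ∀ y ∈ U, Y y = Y' y) (hy : y ∈ U) :
    mlieBracket I X Y y = mlieBracket I X' Y' y :=
  Filter.EventuallyEq.mlieBracket_vectorField_eq
    (Filter.eventually_of_mem (hU.mem_nhds hy) hX) (Filter.eventually_of_mem (hU.mem_nhds hy) hY)

/-! ### Orthonormal frames -/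

/-- A smooth orthonormal frame of the tangent bundle over an open set `U`. -/
structure OrthoFrame {ι : Type*} [Fintype ι] (U : Set M) (F : ι → Π x : M, TangentSpace I x) :
    Prop where
  isOpen : IsOpen U
  smooth : ∀ i, SmoothField U (F i)
  orthonormal : ∀ y ∈ U, Orthonormal ℝ (fun i ↦ F i y)
  card : Fintype.card ι = Module.finrank ℝ E

namespace OrthoFrame

variable {ι : Type*} [Fintype ι] {F : ι → Π x : M, TangentSpace I x}

theorem mono (hF : OrthoFrame V F) (hU : IsOpen U) (h : U ⊆ V) : OrthoFrame U F :=
  ⟨hU, fun i ↦ (hF.smooth i).mono h, fun y hy ↦ hF.orthonormal y (h hy), hF.card⟩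

/-- The orthonormal basis given by an orthonormal frame at a point. -/
def basis (hF : OrthoFrame U F) (hy : y ∈ U) : OrthonormalBasis ι ℝ (TangentSpace I y) :=
  OrthonormalBasis.mk (hF.orthonormal y hy) (by
    have h := (hF.orthonormal y hy).linearIndependent.span_eq_top_of_card_eq_finrank' hF.card
    rw [h])

theorem basis_apply (hF : OrthoFrame U F) (hy : y ∈ U) (i : ι) : hF.basis hy i = F i y := by
  simp [basis]

theorem inner_eq [DecidableEq ι] (hF : OrthoFrame U F) (hy : y ∈ U) (i j : ι) :
    inner ℝ (F i y) (F j y) = if i = j then (1 : ℝ) else 0 :=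
  orthonormal_iff_ite.1 (hF.orthonormal y hy) i j

theorem expand (hF : OrthoFrame U F) (hy : y ∈ U) (v : TangentSpace I y) :
    v = ∑ i, (inner ℝ (F i y) v : ℝ) • F i y := by
  conv_lhs => rw [← (hF.basis hy).sum_repr' v]
  simp only [basis_apply]

theorem sum_inner_mul_inner (hF : OrthoFrame U F) (hy : y ∈ U) (v w : TangentSpace I y) :
    ∑ i, inner ℝ v (F i y) * inner ℝ (F i y) w = (inner ℝ v w : ℝ) := by
  have := (hF.basis hy).sum_inner_mul_inner v w
  simpa only [basis_apply] using this

theorem smoothField_of_inner (hF : OrthoFrame U F)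
    (h : ∀ i, SmoothFun I U (fun y ↦ inner ℝ (X y) (F i y))) : SmoothField U X := by
  refine SmoothField.congr hF.isOpen
    (X := fun y ↦ ∑ i, ((fun y ↦ (inner ℝ (X y) (F i y) : ℝ)) • F i) y)
    (.sum fun i _ ↦ (hF.smooth i).smul (h i)) fun y hy ↦ ?_
  conv_lhs => rw [hF.expand hy (X y)]
  exact Finset.sum_congr rfl fun i _ ↦ by rw [real_inner_comm]; rfl

theorem smoothFun_mvfderiv_frame (hF : OrthoFrame U F) (hf : SmoothFun I U f) (i : ι) :
    SmoothFun I U (fun y ↦ mvfderiv I f y (F i y)) := by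
  classical
  have h := ((hF.smooth i).bracket ((hF.smooth i).smul hf)).inner (hF.smooth i)
  refine h.congr hF.isOpen fun y hy ↦ ?_
  rw [mlieBracket_smul_right (hf.mdiff hy) ((hF.smooth i).mdiff hy)]
  simp [inner_smul_left, (hF.orthonormal y hy).1]

theorem smoothFun_mvfderiv (hF : OrthoFrame U F) (hf : SmoothFun I U f) (hX : SmoothField U X) :
    SmoothFun I U (fun y ↦ mvfderiv I f y (X y)) := by
  refine SmoothFun.congr hF.isOpen
    (f := fun y ↦ ∑ i, inner ℝ (F i y) (X y) * mvfderiv I f y (F i y))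
    (.sum fun i _ ↦ ((hF.smooth i).inner hX).mul (hF.smoothFun_mvfderiv_frame hf i))
    fun y hy ↦ ?_
  conv_lhs => rw [hF.expand hy (X y)]
  simp

theorem mvfderiv_mlieBracket (hF : OrthoFrame U F) (hf : SmoothFun I U f) (hX : SmoothField U X)
    (i : ι) (hy : y ∈ U) :
    mvfderiv I f y (mlieBracket I (F i) X y) =
      mvfderiv I (fun z ↦ mvfderiv I f z (X z)) y (F i y) -
        mvfderiv I (fun z ↦ mvfderiv I f z (F i z)) y (X y) := by
  classical
  have hi := hF.smooth i
  have hXf := hF.smoothFun_mvfderiv hf hX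
  have hif := hF.smoothFun_mvfderiv hf hi
  have e1 : ∀ z ∈ U, mlieBracket I X (f • F i) z =
      ((fun z ↦ mvfderiv I f z (X z)) • F i + f • mlieBracket I X (F i)) z := fun z hz ↦
    mlieBracket_smul_right (hf.mdiff hz) (hi.mdiff hz)
  have e2 : ∀ z ∈ U, mlieBracket I (F i) (f • F i) z =
      ((fun z ↦ mvfderiv I f z (F i z)) • F i + f • mlieBracket I (F i) (F i)) z := fun z hz ↦
    mlieBracket_smul_right (hf.mdiff hz) (hi.mdiff hz)
  have J := jacobi_mlieBracket hi hX (hi.smul hf) hy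
  have J0 := jacobi_mlieBracket hi hX hi hy
  rw [mlieBracket_congr_of_eqOn hF.isOpen (fun _ _ ↦ rfl) e1 hy,
    mlieBracket_congr_of_eqOn hF.isOpen (fun _ _ ↦ rfl) e2 hy,
    mlieBracket_add_right ((hi.smul hXf).mdiff hy) (((hX.bracket hi).smul hf).mdiff hy),
    mlieBracket_add_right ((hi.smul hif).mdiff hy) (((hi.bracket hi).smul hf).mdiff hy),
    mlieBracket_smul_right (hXf.mdiff hy) (hi.mdiff hy),
    mlieBracket_smul_right (hf.mdiff hy) ((hX.bracket hi).mdiff hy),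
    mlieBracket_smul_right (hif.mdiff hy) (hi.mdiff hy),
    mlieBracket_smul_right (hf.mdiff hy) ((hi.bracket hi).mdiff hy),
    mlieBracket_smul_right (hf.mdiff hy) (hi.mdiff hy), J0] at J
  have J' := congrArg (fun v ↦ (inner ℝ v (F i y) : ℝ)) J
  simp only [mlieBracket_self, Pi.zero_apply, smul_zero, add_zero, inner_add_left,
    inner_smul_left, hF.inner_eq hy, mlieBracket_zero_right] at J'
  simp at J'
  linarith

end OrthoFrame

variable {ι : Type*} [Fintype ι] {F : ι → Π x : M, TangentSpace I x}

/-! ### Tensorial operations on smooth vector fields -/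

/-- An operation on vector fields that are smooth on `U`, tensorial at the point `x`. -/
structure FieldTensorial (U : Set M) (x : M) (Φ : (Π x : M, TangentSpace I x) → ℝ) : Prop where
  add : ∀ {X Y}, SmoothField U X → SmoothField U Y → Φ (X + Y) = Φ X + Φ Y
  smul : ∀ {f : M → ℝ} {X}, SmoothFun I U f → SmoothField U X → Φ (f • X) = f x * Φ X
  congr : ∀ {X Y}, SmoothField U X → SmoothField U Y → (∀ y ∈ U, X y = Y y) → Φ X = Φ Y

namespace FieldTensorial

theorem sum {Φ : (Π x : M, TangentSpace I x) → ℝ} (hΦ : FieldTensorial U x Φ) {κ : Type*}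
    {s : Finset κ} {X : κ → Π x : M, TangentSpace I x} (hX : ∀ i ∈ s, SmoothField U (X i)) :
    Φ (fun y ↦ ∑ i ∈ s, X i y) = ∑ i ∈ s, Φ (X i) := by
  classical
  induction s using Finset.induction_on with
  | empty =>
    have h0 : SmoothField U (fun y ↦ ∑ i ∈ (∅ : Finset κ), X i y) := SmoothField.sum hX
    have h1 := hΦ.smul (SmoothFun.const 0) h0
    rw [zero_mul] at h1
    rw [Finset.sum_empty, ← h1]
    congr 1
    ext y
    simp
  | insert a s ha h =>
    simp only [Finset.mem_insert, forall_eq_or_imp] at hX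
    simp only [Finset.sum_insert ha, ← h hX.2]
    exact hΦ.add hX.1 (SmoothField.sum hX.2)

theorem expand {Φ : (Π x : M, TangentSpace I x) → ℝ} (hΦ : FieldTensorial U x Φ)
    (hF : OrthoFrame U F) (hX : SmoothField U X) :
    Φ X = ∑ i, inner ℝ (F i x) (X x) * Φ (F i) := by
  have h (i) : SmoothField U ((fun y ↦ (inner ℝ (F i y) (X y) : ℝ)) • F i) :=
    (hF.smooth i).smul ((hF.smooth i).inner hX)
  rw [hΦ.congr hX (.sum fun i (_ : i ∈ Finset.univ) ↦ h i) fun y hy ↦ hF.expand hy (X y),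
    hΦ.sum fun i _ ↦ h i]
  exact Finset.sum_congr rfl fun i _ ↦ hΦ.smul ((hF.smooth i).inner hX) (hF.smooth i)

end FieldTensorial

/-! ### Smooth connections -/

/-- The connection `D` is smooth on `U`. -/
def SmoothConn (D : CovariantDerivative I E (fun x : M ↦ TangentSpace I x)) (U : Set M) : Prop :=
  ∀ V ⊆ U, IsOpen V → ∀ X Y : Π x : M, TangentSpace I x, SmoothField V X → SmoothField V Y →
    SmoothField V (fun y ↦ D Y y (X y))

section

variable {D : CovariantDerivative I E (fun x : M ↦ TangentSpace I x)}

theorem conn_congr (hU : IsOpen U) (hX : SmoothField U X) (hY : SmoothField U Y)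
    (h : ∀ y ∈ U, X y = Y y) (hy : y ∈ U) : D X y = D Y y :=
  (D.isCovariantDerivativeOn (s := Set.univ)).congr_of_eventuallyEq (hX.mdiff hy) (hY.mdiff hy)
    Filter.univ_mem (Filter.eventually_of_mem (hU.mem_nhds hy) h)

theorem conn_add (hX : SmoothField U X) (hY : SmoothField U Y) (hy : y ∈ U) :
    D (X + Y) y = D X y + D Y y :=
  (D.isCovariantDerivativeOn (s := Set.univ)).add (hX.mdiff hy) (hY.mdiff hy)

theorem conn_smul (hf : SmoothFun I U f) (hX : SmoothField U X) (hy : y ∈ U)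
    (v : TangentSpace I y) : D (f • X) y v = f y • D X y v + mvfderiv I f y v • X y := by
  rw [(D.isCovariantDerivativeOn (s := Set.univ)).leibniz (hX.mdiff hy) (hf.mdiff hy)]
  rfl

theorem conn_inner (hm : D.IsMetricCompatible (V := fun x : M ↦ TangentSpace I x))
    (hX : SmoothField U X) (hY : SmoothField U Y) (hZ : SmoothField U Z) (hy : y ∈ U) :
    mvfderiv I (fun z ↦ (inner ℝ (Y z) (Z z) : ℝ)) y (X y) =
      inner ℝ (D Y y (X y)) (Z y) + inner ℝ (Y y) (D Z y (X y)) := by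
  rw [CovariantDerivative.isMetricCompatible_iff] at hm
  exact hm (hX.mdiff hy) (hY.mdiff hy) (hZ.mdiff hy)

theorem SmoothConn.mono (hD : SmoothConn D U) (h : V ⊆ U) : SmoothConn D V :=
  fun V' h' ↦ hD V' (h'.trans h)

theorem SmoothConn.smooth (hD : SmoothConn D U) (hU : IsOpen U) (hX : SmoothField U X)
    (hY : SmoothField U Y) : SmoothField U (fun y ↦ D Y y (X y)) := hD U le_rfl hU X Y hX hY

end

theorem smoothFun_koszul (hF : OrthoFrame U F) (hX : SmoothField U X) (hY : SmoothField U Y)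
    (hZ : SmoothField U Z) : SmoothFun I U (koszul I X Y Z) :=
  (((((hF.smoothFun_mvfderiv (hY.inner hZ) hX).add (hF.smoothFun_mvfderiv (hZ.inner hX) hY)).sub
    (hF.smoothFun_mvfderiv (hX.inner hY) hZ)).add ((hX.bracket hY).inner hZ)).sub
      ((hY.bracket hZ).inner hX)).add ((hZ.bracket hX).inner hY)

theorem smoothConn_leviCivita (hF : OrthoFrame U F) : SmoothConn (leviCivita I (M := M)) U := by
  intro V hVU hV X Y hX hY
  have hF' := hF.mono hV hVU
  refine hF'.smoothField_of_inner fun i ↦ ?_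
  refine SmoothFun.congr hV
    ((SmoothFun.const (1 / 2)).mul (smoothFun_koszul hF' hX hY (hF'.smooth i))) fun y hy ↦ ?_
  exact inner_leviCivitaFun I (hX.mdiff hy) (hY.mdiff hy) ((hF'.smooth i).mdiff hy)

theorem IsSmoothForm.smoothFun {T : Π x : M, TangentSpace I x [⋀^Fin 3]→L[ℝ] ℝ}
    (hT : IsSmoothForm I T) {X : Fin 3 → Π x : M, TangentSpace I x}
    (hX : ∀ i, SmoothField U (X i)) : SmoothFun I U (fun y ↦ T y (fun i ↦ X i y)) :=
  fun y hy ↦ hT y X fun i ↦ hX i y hy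

theorem IsSmoothForm.smoothFun₃ {T : Π x : M, TangentSpace I x [⋀^Fin 3]→L[ℝ] ℝ}
    (hT : IsSmoothForm I T) (hX : SmoothField U X) (hY : SmoothField U Y) (hZ : SmoothField U Z) :
    SmoothFun I U (fun y ↦ T y ![X y, Y y, Z y]) := by
  have := hT.smoothFun (U := U) (X := ![X, Y, Z])
    (fun i ↦ by fin_cases i <;> simpa using by assumption)
  convert this using 3 with y
  ext i
  fin_cases i <;> rfl

theorem smoothConn_torsionConnection {T : Π x : M, TangentSpace I x [⋀^Fin 3]→L[ℝ] ℝ}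
    (hT : IsSmoothForm I T) (hF : OrthoFrame U F) : SmoothConn (torsionConnection I T) U := by
  intro V hVU hV X Y hX hY
  have hF' := hF.mono hV hVU
  refine hF'.smoothField_of_inner fun i ↦ ?_
  refine SmoothFun.congr hV
    (((smoothConn_leviCivita hF V hVU hV X Y hX hY).inner (hF'.smooth i)).add
      ((SmoothFun.const (1 / 2)).mul (hT.smoothFun₃ hX hY (hF'.smooth i)))) fun y hy ↦ ?_
  rw [torsionConnection_apply, inner_add_left, inner_smul_left, inner_sharp]
  simp

/-! ### Tensoriality of the curvature -/

section

variable {D : CovariantDerivative I E (fun x : M ↦ TangentSpace I x)}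

theorem curvatureOnFields_swap : curvatureOnFields I D X Y Z x = - curvatureOnFields I D Y X Z x := by
  simp only [curvatureOnFields]
  rw [mlieBracket_swap_apply, map_neg]
  abel

theorem fieldTensorial_curvature_left (hU : IsOpen U) (hD : SmoothConn D U)
    (hZ : SmoothField U Z) (hx : x ∈ U) (w : TangentSpace I x) :
    FieldTensorial U x (fun X ↦ (inner ℝ (curvatureOnFields I D X Y Z x) w : ℝ)) where
  add {X X'} hX hX' := by
    have e : (fun y ↦ D Z y ((X + X') y)) = (fun y ↦ D Z y (X y)) + fun y ↦ D Z y (X' y) := by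
      ext1 y; exact map_add _ _ _
    rw [curvatureOnFields, e, conn_add (hD.smooth hU hX hZ) (hD.smooth hU hX' hZ) hx,
      mlieBracket_add_left (hX.mdiff hx) (hX'.mdiff hx), ← inner_add_left]
    congr 1
    simp only [curvatureOnFields, map_add, Pi.add_apply, _root_.add_apply]
    abel
  smul {f X} hf hX := by
    have e : (fun y ↦ D Z y ((f • X) y)) = f • (fun y ↦ D Z y (X y)) := by
      ext1 y; exact map_smul _ _ _
    rw [curvatureOnFields, e, conn_smul hf (hD.smooth hU hX hZ) hx,
      mlieBracket_smul_left (hf.mdiff hx) (hX.mdiff hx), ← real_inner_smul_left]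
    congr 1
    simp only [curvatureOnFields, map_add, map_smul, Pi.smul_apply', map_neg, neg_smul]
    module
  congr {X X'} hX hX' h := by
    have e := conn_congr (D := D) hU (hD.smooth hU hX hZ) (hD.smooth hU hX' hZ)
      (fun y hy ↦ by rw [h y hy]) hx
    simp only [curvatureOnFields]
    rw [e, h x hx, mlieBracket_congr_of_eqOn hU h (fun _ _ ↦ rfl) hx]

theorem fieldTensorial_curvature_right (hF : OrthoFrame U F) (hD : SmoothConn D U)
    (i : ι) (hY : SmoothField U Y) (hx : x ∈ U) (w : TangentSpace I x) :
    FieldTensorial U x (fun Z ↦ (inner ℝ (curvatureOnFields I D (F i) Y Z x) w : ℝ)) where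
  add {Z Z'} hZ hZ' := by
    have hU := hF.isOpen
    have e (X) (hX : SmoothField U X) : D (fun y ↦ D (Z + Z') y (X y)) x =
        D (fun y ↦ D Z y (X y)) x + D (fun y ↦ D Z' y (X y)) x := by
      rw [← conn_add (hD.smooth hU hX hZ) (hD.smooth hU hX hZ') hx]
      refine conn_congr hU (hD.smooth hU hX (hZ.add hZ'))
        ((hD.smooth hU hX hZ).add (hD.smooth hU hX hZ')) (fun y hy ↦ ?_) hx
      rw [conn_add hZ hZ' hy]; rfl
    rw [curvatureOnFields, e _ hY, e _ (hF.smooth i), conn_add hZ hZ' hx, ← inner_add_left]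
    congr 1
    simp only [curvatureOnFields, _root_.add_apply]
    abel
  smul {f Z} hf hZ := by
    have hU := hF.isOpen
    have e (X) (hX : SmoothField U X) (v : TangentSpace I x) :
        D (fun y ↦ D (f • Z) y (X y)) x v =
        f x • D (fun y ↦ D Z y (X y)) x v + mvfderiv I f x v • D Z x (X x) +
        (mvfderiv I f x (X x) • D Z x v + mvfderiv I (fun y ↦ mvfderiv I f y (X y)) x v • Z x) := by
      have h1 := hF.smoothFun_mvfderiv hf hX
      have h2 := (hD.smooth hU hX hZ).smul hf
      rw [← conn_smul hf (hD.smooth hU hX hZ) hx, ← conn_smul h1 hZ hx, ← _root_.add_apply,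
        ← conn_add h2 (hZ.smul h1) hx,
        conn_congr hU (hD.smooth hU hX (hZ.smul hf)) (h2.add (hZ.smul h1)) (fun y hy ↦ ?_) hx]
      rw [conn_smul hf hZ hy]; rfl
    rw [curvatureOnFields, e _ hY, e _ (hF.smooth i), conn_smul hf hZ hx,
      hF.mvfderiv_mlieBracket hf hY i hx, ← real_inner_smul_left]
    congr 1
    simp only [curvatureOnFields]
    module
  congr {Z Z'} hZ hZ' h := by
    have hU := hF.isOpen
    have e (X) (hX : SmoothField U X) : D (fun y ↦ D Z y (X y)) x = D (fun y ↦ D Z' y (X y)) x :=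
      conn_congr hU (hD.smooth hU hX hZ) (hD.smooth hU hX hZ') (fun y hy ↦ by
        rw [conn_congr hU hZ hZ' h hy]) hx
    simp only [curvatureOnFields]
    rw [e _ hY, e _ (hF.smooth i), conn_congr hU hZ hZ' h hx]

theorem inner_curvatureOnFields_expand (hF : OrthoFrame U F) (hD : SmoothConn D U)
    (hX : SmoothField U X) (hY : SmoothField U Y) (hZ : SmoothField U Z) (hx : x ∈ U)
    (w : TangentSpace I x) :
    inner ℝ (curvatureOnFields I D X Y Z x) w =
      ∑ i, ∑ j, ∑ k, inner ℝ (F i x) (X x) * inner ℝ (F j x) (Y x) * inner ℝ (F k x) (Z x) *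
        (inner ℝ (curvatureOnFields I D (F i) (F j) (F k) x) w : ℝ) := by
  rw [(fieldTensorial_curvature_left hF.isOpen hD hZ hx w).expand hF hX]
  refine Finset.sum_congr rfl fun i _ ↦ ?_
  rw [curvatureOnFields_swap, inner_neg_left,
    (fieldTensorial_curvature_left hF.isOpen hD hZ hx w).expand hF hY,
    ← Finset.sum_neg_distrib, Finset.mul_sum]
  refine Finset.sum_congr rfl fun j _ ↦ ?_
  rw [← mul_neg, ← inner_neg_left, ← curvatureOnFields_swap,
    (fieldTensorial_curvature_right hF hD i (hF.smooth j) hx w).expand hF hZ, Finset.mul_sum,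
    Finset.mul_sum]
  refine Finset.sum_congr rfl fun k _ ↦ ?_
  ring

theorem inner_curvature_expand (hF : OrthoFrame U F) (hD : SmoothConn D U)
    (hx : x ∈ U) (u v z w : TangentSpace I x) :
    inner ℝ (curvature I D x u v z) w =
      ∑ i, ∑ j, ∑ k, inner ℝ (F i x) u * inner ℝ (F j x) v * inner ℝ (F k x) z *
        (inner ℝ (curvatureOnFields I D (F i) (F j) (F k) x) w : ℝ) := by
  set B := (trivializationAt E (TangentSpace I) x).baseSet
  have hB : IsOpen (U ∩ B) := hF.isOpen.inter (trivializationAt E (TangentSpace I) x).open_baseSet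
  have hxB : x ∈ U ∩ B := ⟨hx, FiberBundle.mem_baseSet_trivializationAt' x⟩
  have h (v : TangentSpace I x) : SmoothField (U ∩ B) (extend E v) :=
    (smoothField_extend v).mono Set.inter_subset_right
  rw [curvature, inner_curvatureOnFields_expand (hF.mono hB Set.inter_subset_left)
    (hD.mono Set.inter_subset_left) (h u) (h v) (h z) hxB]
  simp only [extend_apply_self]

end

/-! ### Orthonormal frames that are parallel at a point -/

variable (I) in
/-- The function `f` is smooth near `x` and its differential vanishes at `x`. -/
def CriticalAt (x : M) (f : M → ℝ) : Prop :=
  (∀ᶠ y in 𝓝 x, CMDiffAt ∞ f y) ∧ mvfderiv I f x = 0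

/-- The vector field `X` is smooth near `x` and its covariant derivative vanishes at `x`. -/
def ParallelAt (D : CovariantDerivative I E (fun x : M ↦ TangentSpace I x)) (x : M)
    (X : Π x : M, TangentSpace I x) : Prop :=
  (∀ᶠ y in 𝓝 x, CMDiffAt ∞ (T% X) y) ∧ D X x = 0

theorem CriticalAt.mdiff (hf : CriticalAt I x f) : MDiffAt f x :=
  hf.1.self_of_nhds.mdifferentiableAt (by simp)

theorem CriticalAt.mul (hf : CriticalAt I x f) (hg : CriticalAt I x g) :
    CriticalAt I x (fun y ↦ f y * g y) := by
  refine ⟨by filter_upwards [hf.1, hg.1] with y h h' using h.mul h', ?_⟩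
  rw [mvfderiv_fun_mul hf.mdiff hg.mdiff, hf.2, hg.2]
  simp

theorem CriticalAt.comp {φ : ℝ → ℝ} (hφ : ∀ᶠ t in 𝓝 (f x), ContDiffAt ℝ ∞ φ t)
    (hf : CriticalAt I x f) : CriticalAt I x (fun y ↦ φ (f y)) := by
  refine ⟨?_, ?_⟩
  · filter_upwards [hf.1, hf.mdiff.continuousAt.eventually hφ] with y h h'
    exact h'.contMDiffAt.comp y h
  · ext v
    have h' : MDiffAt φ (f x) := hφ.self_of_nhds.contMDiffAt.mdifferentiableAt (by simp)
    have := mvfderiv_comp_apply x h' hf.mdiff v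
    have h0 : mfderiv% f x v = 0 := by
      have := congrArg (fun L ↦ L v) hf.2
      simpa [mvfderiv] using this
    rw [h0, map_zero] at this
    exact this

section

variable {D : CovariantDerivative I E (fun x : M ↦ TangentSpace I x)}

theorem ParallelAt.mdiff (hX : ParallelAt D x X) : MDiffAt (T% X) x :=
  hX.1.self_of_nhds.mdifferentiableAt (by simp)

theorem ParallelAt.sub (hX : ParallelAt D x X) (hY : ParallelAt D x Y) :
    ParallelAt D x (X - Y) := by
  refine ⟨by filter_upwards [hX.1, hY.1] with y h h' using h.sub_section h', ?_⟩
  have h := (D.isCovariantDerivativeOn (s := Set.univ)).add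
    (mdifferentiableAt_sub_section hX.mdiff hY.mdiff) hY.mdiff
  rw [sub_add_cancel, hX.2, hY.2, add_zero] at h
  exact h.symm

theorem ParallelAt.smul (hf : CriticalAt I x f) (hX : ParallelAt D x X) :
    ParallelAt D x (f • X) := by
  refine ⟨by filter_upwards [hf.1, hX.1] with y h h' using h.smul_section h', ?_⟩
  rw [(D.isCovariantDerivativeOn (s := Set.univ)).leibniz hX.mdiff hf.mdiff, hf.2, hX.2]
  ext v
  simp

theorem ParallelAt.zero : ParallelAt D x (fun _ ↦ 0) := by
  refine ⟨.of_forall fun y ↦ (contMDiff_zeroSection ℝ (TangentSpace I)).contMDiffAt, ?_⟩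
  exact congrFun D.zero x

theorem ParallelAt.sum {κ : Type*} {s : Finset κ} {X : κ → Π x : M, TangentSpace I x}
    (hX : ∀ i ∈ s, ParallelAt D x (X i)) : ParallelAt D x (fun y ↦ ∑ i ∈ s, X i y) := by
  classical
  induction s using Finset.induction_on with
  | empty => simpa using ParallelAt.zero
  | insert a s ha h =>
    simp only [Finset.mem_insert, forall_eq_or_imp] at hX
    simp only [Finset.sum_insert ha]
    have h' := h hX.2
    refine ⟨by filter_upwards [hX.1.1, h'.1] with y h h' using h.add_section h', ?_⟩
    have := (D.isCovariantDerivativeOn (s := Set.univ)).add hX.1.mdiff h'.mdiff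
    rw [hX.1.2, h'.2, add_zero] at this
    exact this

theorem ParallelAt.inner (hm : D.IsMetricCompatible (V := fun x : M ↦ TangentSpace I x))
    (hX : ParallelAt D x X) (hY : ParallelAt D x Y) :
    CriticalAt I x (fun y ↦ Inner.inner ℝ (X y) (Y y)) := by
  refine ⟨?_, ?_⟩
  · filter_upwards [hX.1, hY.1] with y h h'
    exact ContMDiffAt.inner_bundle (E := fun x : M ↦ TangentSpace I x) (F := E) h h'
  · ext v
    rw [CovariantDerivative.isMetricCompatible_iff] at hm
    have := hm (mdifferentiableAt_extend I E v) hX.mdiff hY.mdiff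
    beta_reduce at this
    rw [hX.2, hY.2] at this
    simpa using this

theorem parallelAt_gramSchmidt (hm : D.IsMetricCompatible (V := fun x : M ↦ TangentSpace I x))
    {m : ℕ} {X : Fin m → Π x : M, TangentSpace I x} (hX : ∀ i, ParallelAt D x (X i))
    (ho : Orthonormal ℝ (fun i ↦ X i x)) (i : Fin m) :
    ParallelAt D x (fun y ↦ InnerProductSpace.gramSchmidt ℝ (fun i ↦ X i y) i) := by
  have hx : InnerProductSpace.gramSchmidt ℝ (fun i ↦ X i x) = fun i ↦ X i x :=
    InnerProductSpace.gramSchmidt_of_orthogonal ℝ fun i j h ↦ ho.2 h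
  induction i using WellFoundedLT.induction with
  | ind i ih =>
    set G : Fin m → Π x : M, TangentSpace I x :=
      fun i y ↦ InnerProductSpace.gramSchmidt ℝ (fun i ↦ X i y) i with hG
    have e : (fun y ↦ InnerProductSpace.gramSchmidt ℝ (fun i ↦ X i y) i) =
        X i - fun y ↦ ∑ j ∈ Finset.Iio i, ((fun y ↦ (Inner.inner ℝ (G j y) (X i y) : ℝ) *
          (Inner.inner ℝ (G j y) (G j y) : ℝ)⁻¹) • G j) y := by
      ext1 y
      rw [InnerProductSpace.gramSchmidt_def]
      simp only [Submodule.starProjection_singleton]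
      simp [hG, div_eq_mul_inv]
    rw [e]
    refine (hX i).sub (.sum fun j hj ↦ ?_)
    have hj := ih j (Finset.mem_Iio.1 hj)
    refine .smul (((hj.inner hm (hX i))).mul (.comp (φ := fun t ↦ t⁻¹) ?_ (hj.inner hm hj))) hj
    have h1 : (Inner.inner ℝ (G j x) (G j x) : ℝ) ≠ 0 := by
      simp only [hG, hx, real_inner_self_eq_norm_sq, ho.1 j]
      norm_num
    filter_upwards [isOpen_ne.mem_nhds h1] with t ht using contDiffAt_inv ℝ ht

variable (I) in
theorem exists_smooth_mvfderiv_eq (x : M) (L : TangentSpace I x →L[ℝ] ℝ) :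
    ∃ f : M → ℝ, (∀ᶠ y in 𝓝 x, CMDiffAt ∞ f y) ∧ f x = 0 ∧ mvfderiv I f x = L := by
  obtain ⟨e, he⟩ := isInvertible_mfderiv_extChartAt (I := I) (mem_extChartAt_source x)
  have hs : ∀ᶠ y in 𝓝 x, ContMDiffAt I 𝓘(ℝ, E) ∞ (extChartAt I x) y := by
    filter_upwards [(chartAt H x).open_source.mem_nhds (mem_chart_source H x)] with y hy
    exact contMDiffAt_extChartAt' hy
  let L' : E →L[ℝ] ℝ := L ∘L
    (e.symm : TangentSpace 𝓘(ℝ, E) (extChartAt I x x) →L[ℝ] TangentSpace I x)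
  let φ : E → ℝ := fun z ↦ L' z - L' (extChartAt I x x)
  have hφ : ContDiff ℝ ∞ φ := L'.contDiff.sub contDiff_const
  refine ⟨fun y ↦ φ (extChartAt I x y), ?_, by simp [φ], ?_⟩
  · filter_upwards [hs] with y hy
    exact hφ.contDiffAt.contMDiffAt.comp y hy
  · ext v
    have h1 : MDifferentiableAt 𝓘(ℝ, E) 𝓘(ℝ, ℝ) φ (extChartAt I x x) :=
      hφ.contDiffAt.contMDiffAt.mdifferentiableAt (by simp)
    have h2 : MDifferentiableAt I 𝓘(ℝ, E) (extChartAt I x) x :=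
      hs.self_of_nhds.mdifferentiableAt (by simp)
    have := mvfderiv_comp_apply x h1 h2 v
    refine this.trans ?_
    have h3 : ∀ w : E, mvfderiv 𝓘(ℝ, E) φ (extChartAt I x x) w = L' w := by
      intro w
      simp only [mvfderiv, mfderiv_eq_fderiv]
      have : fderiv ℝ φ (extChartAt I x x) = L' := by
        simp only [φ]
        rw [fderiv_sub_const, L'.fderiv]
      change fderiv ℝ φ (extChartAt I x x) w = _
      rw [this]
    rw [← he]
    refine (h3 _).trans ?_
    change L (e.symm (e v)) = L v
    rw [e.symm_apply_apply]

theorem exists_parallelAt {m : ℕ} (b : OrthonormalBasis (Fin m) ℝ (TangentSpace I x))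
    (v : TangentSpace I x) : ∃ X : Π x : M, TangentSpace I x, ParallelAt D x X ∧ X x = v := by
  have hext (w : TangentSpace I x) : ∀ᶠ y in 𝓝 x, CMDiffAt ∞ (T% (extend E w)) y :=
    Filter.eventually_of_mem ((trivializationAt E (TangentSpace I) x).open_baseSet.mem_nhds
      (FiberBundle.mem_baseSet_trivializationAt' x)) (smoothField_extend w)
  choose φ h1 h2 h3 using fun j ↦ exists_smooth_mvfderiv_eq I x
    ((innerSL ℝ (b j)) ∘L D (extend E v) x)
  have hs : ∀ᶠ y in 𝓝 x, CMDiffAt ∞ (T% (fun y ↦ ∑ j, (φ j • extend E (b j)) y)) y := by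
    filter_upwards [Filter.eventually_all.2 fun j ↦ (h1 j).and (hext (b j))] with y hy
    exact .sum_section fun j _ ↦ (hy j).1.smul_section (hy j).2
  have hS : ∀ s : Finset (Fin m), D (fun y ↦ ∑ j ∈ s, (φ j • extend E (b j)) y) x =
      ∑ j ∈ s, ((innerSL ℝ (b j)) ∘L D (extend E v) x).smulRight (b j) := by
    intro s
    have hmd (j) : MDiffAt (T% (φ j • extend E (b j))) x :=
      ((h1 j).self_of_nhds.smul_section (hext (b j)).self_of_nhds).mdifferentiableAt (by simp)
    induction s using Finset.induction_on with
    | empty => simpa using ParallelAt.zero.2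
    | insert a s ha h =>
      simp only [Finset.sum_insert ha, ← h]
      refine ((D.isCovariantDerivativeOn (s := Set.univ)).add (hmd a)
        (.sum_section fun j _ ↦ hmd j)).trans ?_
      congr 1
      rw [(D.isCovariantDerivativeOn (s := Set.univ)).leibniz
        ((hext (b a)).self_of_nhds.mdifferentiableAt (by simp))
        ((h1 a).self_of_nhds.mdifferentiableAt (by simp)), h2, h3]
      simp
  refine ⟨extend E v - fun y ↦ ∑ j, (φ j • extend E (b j)) y, ⟨?_, ?_⟩, by simp [h2]⟩
  · filter_upwards [hext v, hs] with y h h' using h.sub_section h'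
  · have a1 : MDiffAt (T% (extend E v)) x := mdifferentiableAt_extend I E v
    have a2 := hs.self_of_nhds.mdifferentiableAt (by simp)
    have h := (D.isCovariantDerivativeOn (s := Set.univ)).add
      (mdifferentiableAt_sub_section a1 a2) a2
    rw [sub_add_cancel, hS] at h
    ext w
    have h' := congrArg (fun L ↦ L w) h
    have h4 : (∑ j, ((innerSL ℝ (b j)) ∘L D (extend E v) x).smulRight (b j)) w =
        D (extend E v) x w := by
      conv_rhs => rw [← b.sum_repr' (D (extend E v) x w)]
      simp
    simp only [_root_.add_apply] at h'
    rw [h4] at h'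
    simpa using h'

/-- Around every point there is an orthonormal frame that is parallel at the point and has
prescribed values there. -/
theorem exists_orthoFrame (hm : D.IsMetricCompatible (V := fun x : M ↦ TangentSpace I x))
    {m : ℕ} (b : OrthonormalBasis (Fin m) ℝ (TangentSpace I x)) :
    ∃ (U : Set M) (F : Fin m → Π x : M, TangentSpace I x), x ∈ U ∧ OrthoFrame U F ∧
      (∀ i, F i x = b i) ∧ ∀ i, D (F i) x = 0 := by
  choose X hX hXx using fun i ↦ exists_parallelAt (D := D) b (b i)
  have ho : Orthonormal ℝ (fun i ↦ X i x) := by simpa only [hXx] using b.orthonormal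
  have hx : InnerProductSpace.gramSchmidt ℝ (fun i ↦ X i x) = fun i ↦ X i x :=
    InnerProductSpace.gramSchmidt_of_orthogonal ℝ fun i j h ↦ ho.2 h
  set G : Fin m → Π x : M, TangentSpace I x :=
    fun i y ↦ InnerProductSpace.gramSchmidt ℝ (fun i ↦ X i y) i with hG
  have hGp (i) : ParallelAt D x (G i) := parallelAt_gramSchmidt hm hX ho i
  have hGx (i) : G i x = X i x := congrFun hx i
  have h1 (i) : (inner ℝ (G i x) (G i x) : ℝ) = 1 := by
    rw [hGx, real_inner_self_eq_norm_sq, ho.1 i]; norm_num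
  have hφ (i) : CriticalAt I x (fun y ↦ (Real.sqrt (inner ℝ (G i y) (G i y)))⁻¹) := by
    refine .comp (φ := fun t ↦ (Real.sqrt t)⁻¹) ?_ ((hGp i).inner hm (hGp i))
    rw [h1]
    filter_upwards [lt_mem_nhds (zero_lt_one (α := ℝ))] with t ht
    exact (Real.contDiffAt_sqrt ht.ne').inv (Real.sqrt_pos.2 ht).ne'
  let F : Fin m → Π x : M, TangentSpace I x :=
    fun i ↦ (fun y ↦ (Real.sqrt (inner ℝ (G i y) (G i y)))⁻¹) • G i
  have hFp (i) : ParallelAt D x (F i) := (hGp i).smul (hφ i)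
  have hne (i) : ∀ᶠ y in 𝓝 x, (inner ℝ (G i y) (G i y) : ℝ) ≠ 0 := by
    refine ((hGp i).inner hm (hGp i)).mdiff.continuousAt.eventually_ne ?_
    rw [h1]; norm_num
  have hev : ∀ᶠ y in 𝓝 x, ∀ i, CMDiffAt ∞ (T% (F i)) y ∧ (inner ℝ (G i y) (G i y) : ℝ) ≠ 0 :=
    Filter.eventually_all.2 fun i ↦ (hFp i).1.and (hne i)
  obtain ⟨U, hU, hUo, hxU⟩ := eventually_nhds_iff.1 hev
  refine ⟨U, F, hxU, ⟨hUo, fun i y hy ↦ (hU y hy i).1, fun y hy ↦ ⟨fun i ↦ ?_, fun i j hij ↦ ?_⟩,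
    ?_⟩, fun i ↦ ?_, fun i ↦ (hFp i).2⟩
  · have h := (hU y hy i).2
    simp only [F, Pi.smul_apply', norm_smul]
    rw [real_inner_self_eq_norm_sq, Real.sqrt_sq (norm_nonneg _), norm_inv, norm_norm]
    refine inv_mul_cancel₀ fun h0 ↦ h ?_
    rw [real_inner_self_eq_norm_sq, h0]; norm_num
  · simp only [F, Pi.smul_apply', inner_smul_left, inner_smul_right]
    rw [InnerProductSpace.gramSchmidt_orthogonal ℝ _ hij]
    simp
  · exact (Module.finrank_eq_card_basis b.toBasis).symm
  · simp only [F, Pi.smul_apply', hGx, hXx]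
    simp

end

/-! ### Connection coefficients and curvature in an orthonormal frame -/

/-- The connection coefficients `⟨D_{F i} (F j), F k⟩`. -/
def connCoef (D : CovariantDerivative I E (fun x : M ↦ TangentSpace I x))
    (F : ι → Π x : M, TangentSpace I x) (i j k : ι) (y : M) : ℝ :=
  inner ℝ (D (F j) y (F i y)) (F k y)

/-- The curvature coefficients `⟨R(F i, F j) (F k), F l⟩`. -/
def curvCoef (D : CovariantDerivative I E (fun x : M ↦ TangentSpace I x))
    (F : ι → Π x : M, TangentSpace I x) (i j k l : ι) (y : M) : ℝ :=
  inner ℝ (curvatureOnFields I D (F i) (F j) (F k) y) (F l y)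

section

variable {D : CovariantDerivative I E (fun x : M ↦ TangentSpace I x)}

theorem smoothFun_connCoef (hF : OrthoFrame U F) (hD : SmoothConn D U) (i j k : ι) :
    SmoothFun I U (connCoef D F i j k) :=
  (hD.smooth hF.isOpen (hF.smooth i) (hF.smooth j)).inner (hF.smooth k)

theorem connCoef_skew (hm : D.IsMetricCompatible (V := fun x : M ↦ TangentSpace I x))
    (hF : OrthoFrame U F) (hy : y ∈ U) (i j k : ι) :
    connCoef D F i j k y = - connCoef D F i k j y := by
  classical
  have h := conn_inner hm (hF.smooth i) (hF.smooth j) (hF.smooth k) hy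
  rw [mvfderiv_congr hF.isOpen (fun z hz ↦ hF.inner_eq hz j k) hy, mvfderiv_const] at h
  simp only [connCoef]
  rw [real_inner_comm _ (F j y)] at h
  have h0 : (0 : TangentSpace I y →L[ℝ] ℝ) (F i y) = 0 := rfl
  linarith

theorem curvCoef_eq (hm : D.IsMetricCompatible (V := fun x : M ↦ TangentSpace I x))
    (hF : OrthoFrame U F) (hD : SmoothConn D U) (hy : y ∈ U) (i j k l : ι) :
    curvCoef D F i j k l y =
      mvfderiv I (connCoef D F j k l) y (F i y) - mvfderiv I (connCoef D F i k l) y (F j y)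
      - ∑ p, (connCoef D F j k p y * connCoef D F i l p y
          - connCoef D F i k p y * connCoef D F j l p y)
      - ∑ p, inner ℝ (F p y) (mlieBracket I (F i) (F j) y) * connCoef D F p k l y := by
  have hs (j k) := hD.smooth hF.isOpen (hF.smooth j) (hF.smooth k)
  have h1 := conn_inner hm (hF.smooth i) (hs j k) (hF.smooth l) hy
  have h2 := conn_inner hm (hF.smooth j) (hs i k) (hF.smooth l) hy
  have h3 (a b c d) : (inner ℝ (D (F b) y (F a y)) (D (F d) y (F c y)) : ℝ) =
      ∑ p, connCoef D F a b p y * connCoef D F c d p y := by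
    rw [← hF.sum_inner_mul_inner hy]
    refine Finset.sum_congr rfl fun p _ ↦ ?_
    rw [real_inner_comm (D (F d) y (F c y))]; rfl
  have h4 : (inner ℝ (D (F k) y (mlieBracket I (F i) (F j) y)) (F l y) : ℝ) =
      ∑ p, inner ℝ (F p y) (mlieBracket I (F i) (F j) y) * connCoef D F p k l y := by
    conv_lhs => rw [hF.expand hy (mlieBracket I (F i) (F j) y), map_sum, sum_inner]
    refine Finset.sum_congr rfl fun p _ ↦ ?_
    rw [map_smul, real_inner_smul_left]; rfl
  rw [h3] at h1 h2
  rw [curvCoef, curvatureOnFields, inner_sub_left, inner_sub_left, h4, Finset.sum_sub_distrib]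
  change mvfderiv I (connCoef D F j k l) y (F i y) = _ at h1
  change mvfderiv I (connCoef D F i k l) y (F j y) = _ at h2
  linarith

theorem smoothFun_curvCoef (hF : OrthoFrame U F) (hD : SmoothConn D U) (i j k l : ι) :
    SmoothFun I U (curvCoef D F i j k l) := by
  have hs (j k) := hD.smooth hF.isOpen (hF.smooth j) (hF.smooth k)
  exact (((hD.smooth hF.isOpen (hF.smooth i) (hs j k)).sub
    (hD.smooth hF.isOpen (hF.smooth j) (hs i k))).sub (hD.smooth hF.isOpen
      ((hF.smooth i).bracket (hF.smooth j)) (hF.smooth k))).inner (hF.smooth l)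

/-! ### Ricci and scalar curvature in an orthonormal frame -/

theorem sum_basis_eq_sum_frame (hF : OrthoFrame U F) (hy : y ∈ U) {κ : Type*} [Fintype κ]
    (b : OrthonormalBasis κ ℝ (TangentSpace I y)) (c : ι → ι → ℝ) :
    ∑ i, ∑ p, ∑ q, inner ℝ (F p y) (b i) * inner ℝ (F q y) (b i) * c p q = ∑ p, c p p := by
  classical
  rw [Finset.sum_comm]
  refine Finset.sum_congr rfl fun p _ ↦ ?_
  rw [Finset.sum_comm]
  have h (q : ι) : ∑ i, inner ℝ (F p y) (b i) * inner ℝ (F q y) (b i) * c p q =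
      (if p = q then 1 else 0) * c p q := by
    rw [← Finset.sum_mul, ← hF.inner_eq hy, ← b.sum_inner_mul_inner]
    congr 1
    exact Finset.sum_congr rfl fun i _ ↦ by rw [real_inner_comm (b i) (F q y)]
  simp only [h]
  simp

theorem ricci_expand (hF : OrthoFrame U F) (hD : SmoothConn D U) (hy : y ∈ U)
    (u v : TangentSpace I y) :
    ricci I D y u v = ∑ j, ∑ k, inner ℝ (F j y) u * inner ℝ (F k y) v *
      ∑ i, curvCoef D F i j k i y := by
  have h (i) : (inner ℝ (curvature I D y (frame I y i) u v) (frame I y i) : ℝ) =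
      ∑ p, ∑ q, inner ℝ (F p y) (frame I y i) * inner ℝ (F q y) (frame I y i) *
        ∑ j, ∑ k, inner ℝ (F j y) u * inner ℝ (F k y) v * curvCoef D F p j k q y := by
    rw [inner_curvature_expand hF hD hy]
    refine Finset.sum_congr rfl fun p _ ↦ ?_
    have e (j k) : (inner ℝ (curvatureOnFields I D (F p) (F j) (F k) y) (frame I y i) : ℝ) =
        ∑ q, inner ℝ (F q y) (frame I y i) * curvCoef D F p j k q y := by
      rw [← hF.sum_inner_mul_inner hy]
      exact Finset.sum_congr rfl fun q _ ↦ mul_comm _ _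
    simp only [e, Finset.mul_sum]
    rw [Finset.sum_comm' (t' := Finset.univ) (s' := fun _ ↦ Finset.univ) (by simp)]
    rw [Finset.sum_comm]
    conv_rhs => rw [Finset.sum_comm]
    refine Finset.sum_congr rfl fun j _ ↦ ?_
    rw [Finset.sum_comm]
    conv_rhs => rw [Finset.sum_comm]
    conv_lhs => rw [Finset.sum_comm]
    refine Finset.sum_congr rfl fun k _ ↦ Finset.sum_congr rfl fun q _ ↦ ?_
    ring
  rw [ricci, Finset.sum_congr rfl fun i _ ↦ h i, sum_basis_eq_sum_frame hF hy, Finset.sum_comm]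
  refine Finset.sum_congr rfl fun j _ ↦ ?_
  rw [Finset.sum_comm]
  refine Finset.sum_congr rfl fun k _ ↦ ?_
  rw [Finset.mul_sum]

theorem ricci_frame (hF : OrthoFrame U F) (hD : SmoothConn D U) (hy : y ∈ U) (j k : ι) :
    ricci I D y (F j y) (F k y) = ∑ i, curvCoef D F i j k i y := by
  classical
  rw [ricci_expand hF hD hy]
  simp [hF.inner_eq hy]

theorem scalarCurvature_frame (hF : OrthoFrame U F) (hD : SmoothConn D U) (hy : y ∈ U) :
    scalarCurvature I D y = ∑ j, ricci I D y (F j y) (F j y) := by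
  rw [scalarCurvature, Finset.sum_congr rfl fun i _ ↦ ricci_expand hF hD hy _ _,
    sum_basis_eq_sum_frame hF hy]
  exact Finset.sum_congr rfl fun j _ ↦ (ricci_frame hF hD hy j j).symm

end

/-! ### The Levi-Civita connection in a frame parallel at a point -/

theorem mlieBracket_eq_leviCivita (hX : SmoothField U X) (hY : SmoothField U Y) (hy : y ∈ U) :
    mlieBracket I X Y y = leviCivita I Y y (X y) - leviCivita I X y (Y y) :=
  (((CovariantDerivative.torsion_eq_zero_iff _).1 (leviCivita_torsion I (M := M)))
    (hX.mdiff hy) (hY.mdiff hy)).symm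

theorem curvCoef_leviCivita_deriv (hF : OrthoFrame U F) (hx : x ∈ U)
    (h0 : ∀ i, leviCivita I (F i) x = 0) (m i j k l : ι) :
    mvfderiv I (curvCoef (leviCivita I) F i j k l) x (F m x) =
      mvfderiv I (fun y ↦ mvfderiv I (connCoef (leviCivita I) F j k l) y (F i y)) x (F m x) -
      mvfderiv I (fun y ↦ mvfderiv I (connCoef (leviCivita I) F i k l) y (F j y)) x (F m x) := by
  set D := leviCivita I (M := M)
  have hD : SmoothConn D U := smoothConn_leviCivita hF
  have hc (i j k) := smoothFun_connCoef hF hD i j k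
  have hx0 (i j k) : connCoef D F i j k x = 0 := by simp [connCoef, h0]
  have hp (a b c d e f) : (SmoothFun I U fun y ↦ connCoef D F a b c y * connCoef D F d e f y) ∧
      mvfderiv I (fun y ↦ connCoef D F a b c y * connCoef D F d e f y) x (F m x) = 0 := by
    refine ⟨(hc a b c).mul (hc d e f), ?_⟩
    rw [mvfderiv_fun_mul ((hc a b c).mdiff hx) ((hc d e f).mdiff hx), hx0, hx0]
    simp
  have hb (p) : SmoothFun I U (fun y ↦ inner ℝ (F p y) (mlieBracket I (F i) (F j) y)) :=
    (hF.smooth p).inner ((hF.smooth i).bracket (hF.smooth j))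
  have hq (p) : (SmoothFun I U fun y ↦
      inner ℝ (F p y) (mlieBracket I (F i) (F j) y) * connCoef D F p k l y) ∧
      mvfderiv I (fun y ↦ inner ℝ (F p y) (mlieBracket I (F i) (F j) y) * connCoef D F p k l y)
        x (F m x) = 0 := by
    refine ⟨(hb p).mul (hc p k l), ?_⟩
    rw [mvfderiv_fun_mul ((hb p).mdiff hx) ((hc p k l).mdiff hx), hx0,
      mlieBracket_eq_leviCivita (hF.smooth i) (hF.smooth j) hx, h0, h0]
    simp
  have s1 := hF.smoothFun_mvfderiv_frame (hc j k l) i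
  have s2 := hF.smoothFun_mvfderiv_frame (hc i k l) j
  have s3 (p) := (hp j k p i l p).1.sub (hp i k p j l p).1
  have s3' := SmoothFun.sum (s := Finset.univ) fun p _ ↦ s3 p
  have s4' := SmoothFun.sum (s := Finset.univ) fun p _ ↦ (hq p).1
  rw [mvfderiv_congr hF.isOpen
    (fun y hy ↦ curvCoef_eq (leviCivita_isMetricCompatible I) hF hD hy i j k l) hx,
    mvfderiv_sub_apply (((s1.sub s2).sub s3').mdiff hx) (s4'.mdiff hx),
    mvfderiv_sub_apply ((s1.sub s2).mdiff hx) (s3'.mdiff hx),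
    mvfderiv_sub_apply (s1.mdiff hx) (s2.mdiff hx)]
  have z3 : mvfderiv I (fun y ↦ ∑ p, (connCoef D F j k p y * connCoef D F i l p y
          - connCoef D F i k p y * connCoef D F j l p y)) x (F m x) = 0 := by
    rw [mvfderiv_sum fun p _ ↦ (s3 p).mdiff hx]
    refine Finset.sum_eq_zero fun p _ ↦ ?_
    rw [mvfderiv_sub_apply ((hp _ _ _ _ _ _).1.mdiff hx) ((hp _ _ _ _ _ _).1.mdiff hx),
      (hp _ _ _ _ _ _).2, (hp _ _ _ _ _ _).2, sub_zero]
  have z4 : mvfderiv I (fun y ↦ ∑ p, inner ℝ (F p y) (mlieBracket I (F i) (F j) y) *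
      connCoef D F p k l y) x (F m x) = 0 := by
    rw [mvfderiv_sum fun p _ ↦ (hq p).1.mdiff hx]
    exact Finset.sum_eq_zero fun p _ ↦ (hq p).2
  rw [z3, z4, sub_zero, sub_zero]

theorem curvCoef_leviCivita_at (hF : OrthoFrame U F) (hx : x ∈ U)
    (h0 : ∀ i, leviCivita I (F i) x = 0) (i j k l : ι) :
    curvCoef (leviCivita I) F i j k l x =
      mvfderiv I (connCoef (leviCivita I) F j k l) x (F i x) -
        mvfderiv I (connCoef (leviCivita I) F i k l) x (F j x) := by
  rw [curvCoef_eq (leviCivita_isMetricCompatible I) hF (smoothConn_leviCivita hF) hx]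
  simp [connCoef, h0]

theorem sum_swap_skew_eq_zero {c : ι → ι → ℝ} (h : ∀ p q, c p q = - c q p) :
    ∑ p, ∑ q, c p q = 0 := by
  have h1 : ∑ p, ∑ q, c p q = - ∑ p, ∑ q, c p q := by
    conv_lhs => rw [Finset.sum_comm]
    simp only [← Finset.sum_neg_distrib]
    exact Finset.sum_congr rfl fun p _ ↦ Finset.sum_congr rfl fun q _ ↦ h q p
  linarith

/-- The contracted second Bianchi identity. -/
theorem contracted_bianchi (hF : OrthoFrame U F) (hx : x ∈ U)
    (h0 : ∀ i, leviCivita I (F i) x = 0) (m : ι) :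
    mvfderiv I (scalarCurvature I (leviCivita I)) x (F m x) =
      2 * ∑ k, mvfderiv I (fun y ↦ ricci I (leviCivita I) y (F m y) (F k y)) x (F k x) := by
  set D := leviCivita I (M := M)
  have hD : SmoothConn D U := smoothConn_leviCivita hF
  have hU := hF.isOpen
  have hc (i j k) := smoothFun_connCoef hF hD i j k
  let a (m i j k l : ι) : ℝ := mvfderiv I (fun y ↦ mvfderiv I (connCoef D F j k l) y (F i y)) x (F m x)
  have a_symm (m i j k l) : a m i j k l = a i m j k l := by
    have := hF.mvfderiv_mlieBracket (hc j k l) (hF.smooth i) m hx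
    rw [mlieBracket_eq_leviCivita (hF.smooth m) (hF.smooth i) hx, h0, h0] at this
    simp only [_root_.zero_apply, sub_self, map_zero] at this
    simp only [a]
    linarith
  have a_skew (m i j k l) : a m i j k l = - a m i j l k := by
    have e : ∀ y ∈ U, mvfderiv I (connCoef D F j k l) y (F i y) =
        - mvfderiv I (connCoef D F j l k) y (F i y) := fun y hy ↦ by
      rw [mvfderiv_congr hU
        (fun z hz ↦ connCoef_skew (leviCivita_isMetricCompatible I) hF hz j k l) hy, mvfderiv_neg_apply]
    simp only [a]
    rw [mvfderiv_congr hU e hx, mvfderiv_neg_apply]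
  have hR (j k) : ∀ y ∈ U, ricci I D y (F j y) (F k y) = ∑ i, curvCoef D F i j k i y :=
    fun y hy ↦ ricci_frame hF hD hy j k
  have hRs (j k) : SmoothFun I U (fun y ↦ ∑ i, curvCoef D F i j k i y) :=
    SmoothFun.sum fun i _ ↦ smoothFun_curvCoef hF hD i j k i
  have hdR (n j k) : mvfderiv I (fun y ↦ ∑ i, curvCoef D F i j k i y) x (F n x) =
      ∑ i, (a n i j k i - a n j i k i) := by
    rw [mvfderiv_sum fun i _ ↦ (smoothFun_curvCoef hF hD i j k i).mdiff hx]
    exact Finset.sum_congr rfl fun i _ ↦ curvCoef_leviCivita_deriv hF hx h0 n i j k i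
  have hS : ∀ y ∈ U, scalarCurvature I D y = ∑ j, ∑ i, curvCoef D F i j j i y := fun y hy ↦ by
    rw [scalarCurvature_frame hF hD hy]
    exact Finset.sum_congr rfl fun j _ ↦ hR j j y hy
  rw [mvfderiv_congr hU hS hx, mvfderiv_sum fun j _ ↦ (hRs j j).mdiff hx]
  simp only [hdR, Finset.sum_sub_distrib]
  have e1 (k) : mvfderiv I (fun y ↦ ricci I D y (F m y) (F k y)) x (F k x) =
      ∑ i, a k i m k i + ∑ i, a m k i i k := by
    rw [mvfderiv_congr hU (hR m k) hx, hdR, Finset.sum_sub_distrib, sub_eq_add_neg,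
      ← Finset.sum_neg_distrib]
    congr 1
    refine Finset.sum_congr rfl fun i _ ↦ ?_
    rw [a_skew k m i k i, neg_neg, a_symm]
  simp only [e1, Finset.sum_add_distrib]
  rw [sum_swap_skew_eq_zero (c := fun k i ↦ a k i m k i)
    (fun p q ↦ by rw [a_symm p q, a_skew q p])]
  have e2 : ∑ j, ∑ i, a m j i j i = - ∑ j, ∑ i, a m j i i j := by
    simp only [← Finset.sum_neg_distrib]
    exact Finset.sum_congr rfl fun j _ ↦ Finset.sum_congr rfl fun i _ ↦ a_skew _ _ _ _ _
  have e3 : ∑ j, ∑ i, a m i j j i = ∑ j, ∑ i, a m j i i j := Finset.sum_comm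
  rw [e2, e3]
  ring

/-- The Ricci tensor of the Levi-Civita connection is symmetric. -/
theorem ricci_leviCivita_symm_frame (hF : OrthoFrame U F) (hx : x ∈ U)
    (h0 : ∀ i, leviCivita I (F i) x = 0) (j k : ι) :
    ricci I (leviCivita I) x (F j x) (F k x) = ricci I (leviCivita I) x (F k x) (F j x) := by
  set D := leviCivita I (M := M)
  have hD : SmoothConn D U := smoothConn_leviCivita hF
  have hU := hF.isOpen
  have hc (i j k) := smoothFun_connCoef hF hD i j k
  let b (i j k l : ι) : ℝ := mvfderiv I (connCoef D F j k l) x (F i x)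
  have b_skew (i j k l) : b i j k l = - b i j l k := by
    simp only [b]
    rw [mvfderiv_congr hU
      (fun z hz ↦ connCoef_skew (leviCivita_isMetricCompatible I) hF hz j k l) hx, mvfderiv_neg_apply]
  have hbr (i j) : mlieBracket I (F i) (F j) x = 0 := by
    rw [mlieBracket_eq_leviCivita (hF.smooth i) (hF.smooth j) hx, h0, h0]
    simp
  have hbb (i j k l) : inner ℝ (mlieBracket I (F i) (mlieBracket I (F j) (F k)) x) (F l x) =
      b i j k l - b i k j l := by
    have s := (hF.smooth j).bracket (hF.smooth k)
    rw [mlieBracket_eq_leviCivita (hF.smooth i) s hx, h0, hbr, map_zero, sub_zero]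
    have h1 := conn_inner (leviCivita_isMetricCompatible I) (hF.smooth i) s (hF.smooth l) hx
    rw [h0, _root_.zero_apply, inner_zero_right, add_zero] at h1
    rw [← h1]
    have e : ∀ y ∈ U, (inner ℝ (mlieBracket I (F j) (F k) y) (F l y) : ℝ) =
        connCoef D F j k l y - connCoef D F k j l y := fun y hy ↦ by
      rw [mlieBracket_eq_leviCivita (hF.smooth j) (hF.smooth k) hy, inner_sub_left]; rfl
    rw [mvfderiv_congr hU e hx, mvfderiv_fun_sub ((hc _ _ _).mdiff hx) ((hc _ _ _).mdiff hx)]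
    rfl
  have J (i) : b i j k i - b i k j i + (b j k i i - b j i k i) + (b k i j i - b k j i i) = 0 := by
    have h := jacobi_mlieBracket (hF.smooth i) (hF.smooth j) (hF.smooth k) hx
    rw [mlieBracket_swap_apply (V := mlieBracket I (F i) (F j)),
      show mlieBracket I (F i) (F k) = - mlieBracket I (F k) (F i) from mlieBracket_swap] at h
    have h' := congrArg (fun v ↦ (inner ℝ v (F i x) : ℝ)) h
    have e : mlieBracket I (F j) (-mlieBracket I (F k) (F i)) x =
        - mlieBracket I (F j) (mlieBracket I (F k) (F i)) x := by
      have := mlieBracket_const_smul_right (I := I) (V := F j) (c := (-1 : ℝ))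
        (((hF.smooth k).bracket (hF.smooth i)).mdiff hx)
      simpa using this
    rw [e] at h'
    simp only [inner_add_left, inner_neg_left, hbb] at h'
    linarith
  rw [ricci_frame hF hD hx, ricci_frame hF hD hx, ← sub_eq_zero, ← Finset.sum_sub_distrib]
  refine Finset.sum_eq_zero fun i _ ↦ ?_
  rw [curvCoef_leviCivita_at hF hx h0, curvCoef_leviCivita_at hF hx h0]
  have := J i
  have h1 := b_skew j k i i
  have h2 := b_skew k j i i
  change b i j k i - b j i k i - (b i k j i - b k i j i) = 0
  linarith

theorem ricci_leviCivita_symm {m : ℕ} (b : OrthonormalBasis (Fin m) ℝ (TangentSpace I x))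
    (j k : Fin m) :
    ricci I (leviCivita I) x (b j) (b k) = ricci I (leviCivita I) x (b k) (b j) := by
  obtain ⟨U, F, hx, hF, hb, h0⟩ := exists_orthoFrame (leviCivita_isMetricCompatible I) b
  rw [← hb, ← hb]
  exact ricci_leviCivita_symm_frame hF hx h0 j k

variable {T : Π x : M, TangentSpace I x [⋀^Fin 3]→L[ℝ] ℝ}

/-! ### Covariant derivatives of 3-forms -/

theorem form_add_left (u u' v w : TangentSpace I x) :
    T x ![u + u', v, w] = T x ![u, v, w] + T x ![u', v, w] :=
  (T x).toAlternatingMap.map_vecCons_add ![v, w] u u'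

theorem form_smul_left (c : ℝ) (u v w : TangentSpace I x) :
    T x ![c • u, v, w] = c * T x ![u, v, w] :=
  (T x).toAlternatingMap.map_vecCons_smul ![v, w] c u

theorem form_neg_left (u v w : TangentSpace I x) : T x ![-u, v, w] = - T x ![u, v, w] := by
  rw [← neg_one_smul ℝ u, form_smul_left, neg_one_mul]

theorem form_sub_left (u u' v w : TangentSpace I x) :
    T x ![u - u', v, w] = T x ![u, v, w] - T x ![u', v, w] := by
  rw [sub_eq_add_neg, form_add_left, form_neg_left, sub_eq_add_neg]

theorem form_zero_left (v w : TangentSpace I x) : T x ![0, v, w] = 0 := by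
  rw [← zero_smul ℝ (0 : TangentSpace I x), form_smul_left, zero_mul]

theorem form_swap_left (u v w : TangentSpace I x) : T x ![v, u, w] = - T x ![u, v, w] := by
  have := (T x).toAlternatingMap.map_swap ![u, v, w] (i := 0) (j := 1) (by decide)
  rw [ContinuousAlternatingMap.coe_toAlternatingMap] at this
  rw [← this]
  congr 1
  ext i
  fin_cases i <;> simp [Equiv.swap_apply_def]

theorem form_swap_right (u v w : TangentSpace I x) : T x ![u, w, v] = - T x ![u, v, w] := by
  have := (T x).toAlternatingMap.map_swap ![u, v, w] (i := 1) (j := 2) (by decide)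
  rw [ContinuousAlternatingMap.coe_toAlternatingMap] at this
  rw [← this]
  congr 1
  ext i
  fin_cases i <;> simp [Equiv.swap_apply_def]

theorem form_rotate (u v w : TangentSpace I x) : T x ![v, w, u] = T x ![u, v, w] := by
  rw [form_swap_right, form_swap_left, neg_neg]

/-- The covariant derivative `(D_u T)(X, Y, Z)` on vector fields. -/
def covDerivOnFields (D : CovariantDerivative I E (fun x : M ↦ TangentSpace I x))
    (T : Π x : M, TangentSpace I x [⋀^Fin 3]→L[ℝ] ℝ) (x : M) (u : TangentSpace I x)
    (X Y Z : Π x : M, TangentSpace I x) : ℝ :=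
  mvfderiv I (fun y ↦ T y ![X y, Y y, Z y]) x u - (T x ![D X x u, Y x, Z x]
    + T x ![X x, D Y x u, Z x] + T x ![X x, Y x, D Z x u])

section

variable {D : CovariantDerivative I E (fun x : M ↦ TangentSpace I x)}

theorem covDerivForm_eq (u a b c : TangentSpace I x) :
    covDerivForm I D T x u ![a, b, c] =
      covDerivOnFields D T x u (extend E a) (extend E b) (extend E c) := by
  have e : ∀ y, (fun i ↦ extend E ((![a, b, c] : Fin 3 → TangentSpace I x) i) y) =
      ![extend E a y, extend E b y, extend E c y] := by
    intro y
    ext i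
    fin_cases i <;> rfl
  have e0 (v) : Function.update (![a, b, c] : Fin 3 → TangentSpace I x) 0 v = ![v, b, c] := by
    ext i; fin_cases i <;> rfl
  have e1 (v) : Function.update (![a, b, c] : Fin 3 → TangentSpace I x) 1 v = ![a, v, c] := by
    ext i; fin_cases i <;> rfl
  have e2 (v) : Function.update (![a, b, c] : Fin 3 → TangentSpace I x) 2 v = ![a, b, v] := by
    ext i; fin_cases i <;> rfl
  simp only [covDerivForm, covDerivOnFields, e, Fin.sum_univ_three, e0, e1, e2, extend_apply_self]
  rfl

theorem covDerivOnFields_swap_left (u : TangentSpace I x) :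
    covDerivOnFields D T x u Y X Z = - covDerivOnFields D T x u X Y Z := by
  have e : (fun y ↦ T y ![Y y, X y, Z y]) = fun y ↦ - T y ![X y, Y y, Z y] :=
    funext fun y ↦ form_swap_left _ _ _
  simp only [covDerivOnFields]
  rw [e, mvfderiv_neg_apply, form_swap_left (X x) (D Y x u), form_swap_left (D X x u) (Y x),
    form_swap_left (X x) (Y x)]
  ring

theorem covDerivOnFields_swap_right (u : TangentSpace I x) :
    covDerivOnFields D T x u X Z Y = - covDerivOnFields D T x u X Y Z := by
  have e : (fun y ↦ T y ![X y, Z y, Y y]) = fun y ↦ - T y ![X y, Y y, Z y] :=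
    funext fun y ↦ form_swap_right _ _ _
  simp only [covDerivOnFields]
  rw [e, mvfderiv_neg_apply, form_swap_right (X x) (D Y x u), form_swap_right (D X x u) (Y x),
    form_swap_right (X x) (Y x)]
  ring

theorem fieldTensorial_covDeriv (hU : IsOpen U) (hT : IsSmoothForm I T) (hY : SmoothField U Y)
    (hZ : SmoothField U Z) (hx : x ∈ U) (u : TangentSpace I x) :
    FieldTensorial U x (fun X ↦ covDerivOnFields D T x u X Y Z) where
  add {X X'} hX hX' := by
    have e : (fun y ↦ T y ![(X + X') y, Y y, Z y]) =
        fun y ↦ T y ![X y, Y y, Z y] + T y ![X' y, Y y, Z y] :=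
      funext fun y ↦ form_add_left _ _ _ _
    simp only [covDerivOnFields]
    rw [e, mvfderiv_add_apply ((hT.smoothFun₃ hX hY hZ).mdiff hx)
      ((hT.smoothFun₃ hX' hY hZ).mdiff hx), conn_add hX hX' hx]
    simp only [_root_.add_apply, Pi.add_apply, form_add_left]
    ring
  smul {f X} hf hX := by
    have e : (fun y ↦ T y ![(f • X) y, Y y, Z y]) = fun y ↦ f y * T y ![X y, Y y, Z y] :=
      funext fun y ↦ form_smul_left _ _ _ _
    simp only [covDerivOnFields]
    rw [e, mvfderiv_mul_apply (hf.mdiff hx) ((hT.smoothFun₃ hX hY hZ).mdiff hx),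
      conn_smul hf hX hx]
    simp only [Pi.smul_apply', form_add_left, form_smul_left]
    ring
  congr {X X'} hX hX' h := by
    simp only [covDerivOnFields]
    rw [mvfderiv_congr hU (fun y hy ↦ by rw [h y hy]) hx, conn_congr hU hX hX' h hx, h x hx]

theorem covDerivOnFields_congr_left (hF : OrthoFrame U F) (hT : IsSmoothForm I T)
    {X' : Π x : M, TangentSpace I x} (hX : SmoothField U X) (hX' : SmoothField U X')
    (hY : SmoothField U Y) (hZ : SmoothField U Z) (hx : x ∈ U) (h : X x = X' x)
    (u : TangentSpace I x) :
    covDerivOnFields D T x u X Y Z = covDerivOnFields D T x u X' Y Z := by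
  have hΦ := fieldTensorial_covDeriv (D := D) hF.isOpen hT hY hZ hx u
  rw [hΦ.expand hF hX, hΦ.expand hF hX', h]

theorem covDerivForm_frame (hF : OrthoFrame U F) (hT : IsSmoothForm I T) (hx : x ∈ U)
    (u : TangentSpace I x) (a b c : ι) :
    covDerivForm I D T x u ![F a x, F b x, F c x] =
      covDerivOnFields D T x u (F a) (F b) (F c) := by
  set B := (trivializationAt E (TangentSpace I) x).baseSet
  have hB : IsOpen (U ∩ B) := hF.isOpen.inter (trivializationAt E (TangentSpace I) x).open_baseSet
  have hxB : x ∈ U ∩ B := ⟨hx, FiberBundle.mem_baseSet_trivializationAt' x⟩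
  have he (v : TangentSpace I x) : SmoothField (U ∩ B) (extend E v) :=
    (smoothField_extend v).mono Set.inter_subset_right
  have hF' := hF.mono hB Set.inter_subset_left
  have hs := hF'.smooth
  rw [covDerivForm_eq,
    covDerivOnFields_congr_left hF' hT (he _) (hs a) (he _) (he _) hxB (extend_apply_self _ _),
    covDerivOnFields_swap_left,
    covDerivOnFields_congr_left hF' hT (he _) (hs b) (hs a) (he _) hxB (extend_apply_self _ _),
    covDerivOnFields_swap_right, covDerivOnFields_swap_left,
    covDerivOnFields_congr_left hF' hT (he _) (hs c) (hs b) (hs a) hxB (extend_apply_self _ _),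
    covDerivOnFields_swap_left, covDerivOnFields_swap_right, covDerivOnFields_swap_left]
  ring

theorem covDerivForm_frame_parallel (hF : OrthoFrame U F) (hT : IsSmoothForm I T) (hx : x ∈ U)
    (h0 : ∀ i, D (F i) x = 0) (u : TangentSpace I x) (a b c : ι) :
    covDerivForm I D T x u ![F a x, F b x, F c x] =
      mvfderiv I (fun y ↦ T y ![F a y, F b y, F c y]) x u := by
  rw [covDerivForm_frame hF hT hx, covDerivOnFields]
  simp only [h0, _root_.zero_apply]
  rw [form_swap_left 0 (F a x), form_rotate 0 (F a x), form_zero_left, form_zero_left,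
    form_zero_left]
  ring

end

/-- The exterior derivative in terms of the Levi-Civita connection. -/
theorem extDeriv_eq_covDeriv (u v w z : TangentSpace I x) :
    extDeriv I T x u v w z =
      covDerivForm I (leviCivita I) T x u ![v, w, z] - covDerivForm I (leviCivita I) T x v ![u, w, z]
        + covDerivForm I (leviCivita I) T x w ![u, v, z]
        - covDerivForm I (leviCivita I) T x z ![u, v, w] := by
  have hx : x ∈ (trivializationAt E (TangentSpace I) x).baseSet :=
    FiberBundle.mem_baseSet_trivializationAt' x
  have hb (a b : TangentSpace I x) : mlieBracket I (extend E a) (extend E b) x =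
      leviCivita I (extend E b) x a - leviCivita I (extend E a) x b := by
    have := mlieBracket_eq_leviCivita (smoothField_extend a) (smoothField_extend b) hx
    simpa only [extend_apply_self] using this
  simp only [covDerivForm_eq, extDeriv, extDerivOnFields, covDerivOnFields, hb, extend_apply_self,
    form_sub_left]
  set D := leviCivita I (M := M)
  have s (a b c : TangentSpace I x) := form_swap_left (T := T) a b c
  have r (a b c : TangentSpace I x) := form_rotate (T := T) a b c
  have q (a b c : TangentSpace I x) := form_swap_right (T := T) a b c
  rw [s (D (extend E w) x u) v z, r (D (extend E z) x u) v w,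
    s (D (extend E w) x v) u z, r (D (extend E z) x v) u w,
    s (D (extend E v) x w) u z, r (D (extend E z) x w) u v,
    s (D (extend E v) x z) u w, r (D (extend E w) x z) u v]
  ring

theorem extDeriv_frame (hF : OrthoFrame U F) (hT : IsSmoothForm I T) (hx : x ∈ U)
    (h0 : ∀ i, leviCivita I (F i) x = 0) (i j k l : ι) :
    extDeriv I T x (F i x) (F j x) (F k x) (F l x) =
      mvfderiv I (fun y ↦ T y ![F j y, F k y, F l y]) x (F i x)
        - mvfderiv I (fun y ↦ T y ![F i y, F k y, F l y]) x (F j x)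
        + mvfderiv I (fun y ↦ T y ![F i y, F j y, F l y]) x (F k x)
        - mvfderiv I (fun y ↦ T y ![F i y, F j y, F k y]) x (F l x) := by
  simp only [extDeriv_eq_covDeriv, covDerivForm_frame_parallel hF hT hx h0]

/-! ### The Ricci tensor of the torsion connection -/

theorem connCoef_torsionConnection (i j k : ι) (y : M) :
    connCoef (torsionConnection I T) F i j k y =
      connCoef (leviCivita I) F i j k y + 1 / 2 * T y ![F i y, F j y, F k y] := by
  simp only [connCoef]
  rw [torsionConnection_apply, inner_add_left, real_inner_smul_left, inner_sharp]

theorem ricci_torsionConnection_frame (hF : OrthoFrame U F) (hT : IsSmoothForm I T) (hx : x ∈ U)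
    (h0 : ∀ i, leviCivita I (F i) x = 0) (j k : ι) :
    ricci I (torsionConnection I T) x (F j x) (F k x) =
      ricci I (leviCivita I) x (F j x) (F k x)
        + 1 / 2 * ∑ i, mvfderiv I (fun y ↦ T y ![F j y, F k y, F i y]) x (F i x)
        - 1 / 4 * ∑ a, ∑ b, T x ![F j x, F a x, F b x] * T x ![F k x, F a x, F b x] := by
  have hDg := smoothConn_leviCivita hF
  have hDt := smoothConn_torsionConnection hT hF
  have hTs (i j k) := hT.smoothFun₃ (hF.smooth i) (hF.smooth j) (hF.smooth k)
  have hcg (i j k) := smoothFun_connCoef hF hDg i j k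
  have hx0 (i j k) : connCoef (leviCivita I) F i j k x = 0 := by simp [connCoef, h0]
  have hd (i j k m) : mvfderiv I (connCoef (torsionConnection I T) F i j k) x (F m x) =
      mvfderiv I (connCoef (leviCivita I) F i j k) x (F m x) +
        1 / 2 * mvfderiv I (fun y ↦ T y ![F i y, F j y, F k y]) x (F m x) := by
    rw [mvfderiv_congr hF.isOpen (fun y _ ↦ connCoef_torsionConnection i j k y) hx,
      mvfderiv_add_apply ((hcg i j k).mdiff hx)
        (((SmoothFun.const (1 / 2)).mul (hTs i j k)).mdiff hx),
      mvfderiv_const_mul_apply _ ((hTs i j k).mdiff hx)]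
  have hTii (a b) : ∀ y, T y ![F a y, F b y, F a y] = 0 := fun y ↦ by
    have := form_rotate (T := T) (F a y) (F a y) (F b y)
    have h1 := form_swap_right (T := T) (F a y) (F b y) (F a y)
    linarith
  have hTii' (a b) : ∀ y, T y ![F a y, F a y, F b y] = 0 := fun y ↦ by
    rw [form_swap_right, hTii, neg_zero]
  have hbr (i j) : mlieBracket I (F i) (F j) x = 0 := by
    rw [mlieBracket_eq_leviCivita (hF.smooth i) (hF.smooth j) hx, h0, h0]
    simp
  have key (i) : curvCoef (torsionConnection I T) F i j k i x =
      curvCoef (leviCivita I) F i j k i x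
        + 1 / 2 * mvfderiv I (fun y ↦ T y ![F j y, F k y, F i y]) x (F i x)
        - 1 / 4 * ∑ p, T x ![F j x, F p x, F i x] * T x ![F k x, F p x, F i x] := by
    rw [curvCoef_eq (torsionConnection_isMetricCompatible I T) hF hDt hx, hd, hd,
      curvCoef_leviCivita_at hF hx h0]
    have z : mvfderiv I (fun y ↦ T y ![F i y, F k y, F i y]) x (F j x) = 0 := by
      rw [mvfderiv_congr hF.isOpen (fun y _ ↦ hTii i k y) hx, mvfderiv_const]
      rfl
    simp only [z, hbr, inner_zero_right, zero_mul, Finset.sum_const_zero, hTii', hx0, zero_add,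
      connCoef_torsionConnection]
    have e : ∑ p, (1 / 2 * T x ![F j x, F k x, F p x] * (1 / 2 * 0) -
        1 / 2 * T x ![F i x, F k x, F p x] * (1 / 2 * T x ![F j x, F i x, F p x])) =
        1 / 4 * ∑ p, T x ![F j x, F p x, F i x] * T x ![F k x, F p x, F i x] := by
      rw [Finset.mul_sum]
      refine Finset.sum_congr rfl fun p _ ↦ ?_
      rw [form_swap_right (F j x) (F p x) (F i x), ← form_rotate (F i x) (F k x) (F p x)]
      ring
    rw [e]
    ring
  rw [ricci_frame hF hDt hx, ricci_frame hF hDg hx, Finset.sum_congr rfl fun i _ ↦ key i,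
    Finset.sum_sub_distrib, Finset.sum_add_distrib, ← Finset.mul_sum, ← Finset.mul_sum]
  congr 2
  exact Finset.sum_comm

/-- The symmetric part of the Ricci tensor of the torsion connection. -/
theorem ricci_torsionConnection_symm (hT : IsSmoothForm I T) {m : ℕ}
    (b : OrthonormalBasis (Fin m) ℝ (TangentSpace I x)) (j k : Fin m) :
    ricci I (torsionConnection I T) x (b j) (b k) + ricci I (torsionConnection I T) x (b k) (b j) =
      2 * ricci I (leviCivita I) x (b j) (b k)
        - 1 / 2 * ∑ p, ∑ q, T x ![b j, b p, b q] * T x ![b k, b p, b q] := by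
  have hsymm := ricci_leviCivita_symm b j k
  obtain ⟨U, F, hx, hF, hb, h0⟩ := exists_orthoFrame (leviCivita_isMetricCompatible I) b
  have hTs (i j k) := hT.smoothFun₃ (hF.smooth i) (hF.smooth j) (hF.smooth k)
  simp only [← hb] at hsymm ⊢
  rw [ricci_torsionConnection_frame hF hT hx h0, ricci_torsionConnection_frame hF hT hx h0, ← hsymm]
  have e1 : ∑ i, mvfderiv I (fun y ↦ T y ![F k y, F j y, F i y]) x (F i x) =
      - ∑ i, mvfderiv I (fun y ↦ T y ![F j y, F k y, F i y]) x (F i x) := by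
    rw [← Finset.sum_neg_distrib]
    refine Finset.sum_congr rfl fun i _ ↦ ?_
    rw [← mvfderiv_neg_apply,
      mvfderiv_congr hF.isOpen (fun y _ ↦ form_swap_left (F j y) (F k y) (F i y)) hx]
  have e2 : ∑ p, ∑ q, T x ![F k x, F p x, F q x] * T x ![F j x, F p x, F q x] =
      ∑ p, ∑ q, T x ![F j x, F p x, F q x] * T x ![F k x, F p x, F q x] :=
    Finset.sum_congr rfl fun p _ ↦ Finset.sum_congr rfl fun q _ ↦ mul_comm _ _
  rw [e1, e2]
  ring

/-! ### The scalar curvature of a `∇`-Einstein connection in dimension six -/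

theorem ricci_leviCivita_of_isNablaEinstein (hT : IsSmoothForm I T)
    (hf : ∀ (x : M) (u v : TangentSpace I x),
      (ricci I (torsionConnection I T) x u v + ricci I (torsionConnection I T) x v u) / 2 =
        f x * inner ℝ u v) {m : ℕ} {F : Fin m → Π x : M, TangentSpace I x}
    (hF : OrthoFrame U F) (hy : y ∈ U) (j k : Fin m) :
    ricci I (leviCivita I) y (F j y) (F k y) = f y * (if j = k then 1 else 0)
      + 1 / 4 * ∑ p, ∑ q, T y ![F j y, F p y, F q y] * T y ![F k y, F p y, F q y] := by
  have h := ricci_torsionConnection_symm hT (hF.basis hy) j k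
  have h' := hf y (F j y) (F k y)
  simp only [hF.basis_apply] at h
  rw [h, hF.inner_eq hy] at h'
  linarith

theorem smoothFun_scalarCurvature_leviCivita (hF : OrthoFrame U F) :
    SmoothFun I U (scalarCurvature I (leviCivita I)) := by
  have hD := smoothConn_leviCivita hF
  refine SmoothFun.congr hF.isOpen (f := fun y ↦ ∑ j, ∑ i, curvCoef (leviCivita I) F i j j i y)
    (.sum fun j _ ↦ .sum fun i _ ↦ smoothFun_curvCoef hF hD i j j i) fun y hy ↦ ?_
  rw [scalarCurvature_frame hF hD hy]
  exact Finset.sum_congr rfl fun j _ ↦ ricci_frame hF hD hy j j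

theorem mdifferentiableAt_scalarCurvature_leviCivita (x : M) :
    MDiffAt (scalarCurvature I (leviCivita I) : M → ℝ) x := by
  obtain ⟨U, F, hx, hF, -, -⟩ := exists_orthoFrame (leviCivita_isMetricCompatible I) (frame I x)
  exact (smoothFun_scalarCurvature_leviCivita hF).mdiff hx

theorem bigTheta_frame {m : ℕ} {τ : Fin m → Fin m → Fin m → ℝ} {t : Fin m → Fin m → Fin m → Fin m → ℝ}
    (h1 : ∀ a b c, τ b a c = - τ a b c) (h2 : ∀ a b c, τ b c a = τ a b c) (j : Fin m) :
    ∑ a, ∑ b, ∑ c, τ a b c * (t j a b c - t a j b c + t b j a c - t c j a b) =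
      ∑ a, ∑ b, ∑ c, τ a b c * t j a b c - 3 * ∑ a, ∑ b, ∑ c, τ a b c * t a j b c := by
  have e1 : ∑ a, ∑ b, ∑ c, τ a b c * t b j a c = - ∑ a, ∑ b, ∑ c, τ a b c * t a j b c := by
    rw [Finset.sum_comm]
    simp only [← Finset.sum_neg_distrib]
    refine Finset.sum_congr rfl fun a _ ↦ Finset.sum_congr rfl fun b _ ↦
      Finset.sum_congr rfl fun c _ ↦ ?_
    rw [h1]; ring
  have e2 : ∑ a, ∑ b, ∑ c, τ a b c * t c j a b = ∑ a, ∑ b, ∑ c, τ a b c * t a j b c := by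
    conv_rhs => rw [Finset.sum_comm]
    conv_rhs => enter [2, b]; rw [Finset.sum_comm]
    refine Finset.sum_congr rfl fun a _ ↦ Finset.sum_congr rfl fun b _ ↦
      Finset.sum_congr rfl fun c _ ↦ ?_
    rw [h2 c a b]
  simp only [mul_sub, mul_add, Finset.sum_sub_distrib, Finset.sum_add_distrib]
  rw [e1, e2]
  ring

theorem mvfderiv_scalarCurvature_eq_zero (hn : Module.finrank ℝ E = 6) (hT : IsSmoothForm I T)
    (hθ : ∀ (x : M) (u : TangentSpace I x), 3 * theta I T x u + bigTheta I T x u = 0)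
    (hE : IsNablaEinstein I (torsionConnection I T)) (x : M) :
    mvfderiv I (scalarCurvature I (leviCivita I)) x = 0 := by
  obtain ⟨f, hf⟩ := hE
  obtain ⟨U, F, hx, hF, hb, h0⟩ := exists_orthoFrame (leviCivita_isMetricCompatible I) (frame I x)
  have hU := hF.isOpen
  set S : M → ℝ := scalarCurvature I (leviCivita I) with hS
  have hSs : SmoothFun I U S := smoothFun_scalarCurvature_leviCivita hF
  let τ (a b c) (y : M) : ℝ := T y ![F a y, F b y, F c y]
  let t (m a b c) : ℝ := mvfderiv I (τ a b c) x (F m x)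
  have hτ (a b c) : SmoothFun I U (τ a b c) := hT.smoothFun₃ (hF.smooth a) (hF.smooth b) (hF.smooth c)
  let N (y : M) : ℝ := ∑ a, ∑ p, ∑ q, τ a p q y * τ a p q y
  let Q (j k) (y : M) : ℝ := ∑ p, ∑ q, τ j p q y * τ k p q y
  have hQs (j k) : SmoothFun I U (Q j k) := .sum fun p _ ↦ .sum fun q _ ↦ (hτ j p q).mul (hτ k p q)
  have hNs : SmoothFun I U N := .sum fun a _ ↦ hQs a a
  have hdQ (j k m) : mvfderiv I (Q j k) x (F m x) =
      ∑ p, ∑ q, (τ j p q x * t m k p q + τ k p q x * t m j p q) := by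
    rw [mvfderiv_sum fun p _ ↦
      (SmoothFun.sum fun q (_ : q ∈ Finset.univ) ↦ (hτ j p q).mul (hτ k p q)).mdiff hx]
    refine Finset.sum_congr rfl fun p _ ↦ ?_
    rw [mvfderiv_sum fun q _ ↦ ((hτ j p q).mul (hτ k p q)).mdiff hx]
    exact Finset.sum_congr rfl fun q _ ↦ mvfderiv_mul_apply ((hτ j p q).mdiff hx)
      ((hτ k p q).mdiff hx) _
  have hdN (m) : mvfderiv I N x (F m x) = 2 * ∑ a, ∑ b, ∑ c, τ a b c x * t m a b c := by
    rw [mvfderiv_sum fun a _ ↦ (hQs a a).mdiff hx, Finset.mul_sum]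
    refine Finset.sum_congr rfl fun a _ ↦ ?_
    rw [hdQ, Finset.mul_sum]
    refine Finset.sum_congr rfl fun p _ ↦ ?_
    rw [Finset.mul_sum]
    exact Finset.sum_congr rfl fun q _ ↦ by ring
  have hric (j k) : ∀ y ∈ U, ricci I (leviCivita I) y (F j y) (F k y) =
      f y * (if j = k then 1 else 0) + 1 / 4 * Q j k y := fun y hy ↦
    ricci_leviCivita_of_isNablaEinstein hT hf hF hy j k
  have hSN : ∀ y ∈ U, S y = 6 * f y + 1 / 4 * N y := fun y hy ↦ by
    rw [hS, scalarCurvature_frame hF (smoothConn_leviCivita hF) hy,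
      Finset.sum_congr rfl fun j _ ↦ hric j j y hy, Finset.sum_add_distrib, ← Finset.mul_sum,
      ← Finset.mul_sum]
    have := hF.card
    simp only [if_true, Finset.sum_const, Finset.card_univ, this, hn]
    norm_num [N, Q]
    ring
  have hric' (j k) : ∀ y ∈ U, ricci I (leviCivita I) y (F j y) (F k y) =
      (if j = k then 1 / 6 else 0) * (S y - 1 / 4 * N y) + 1 / 4 * Q j k y := fun y hy ↦ by
    rw [hric j k y hy, hSN y hy]
    split_ifs <;> ring
  have hSN' := hSs.sub ((SmoothFun.const (1 / 4)).mul hNs)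
  have hdric (j k m) : mvfderiv I (fun y ↦ ricci I (leviCivita I) y (F j y) (F k y)) x (F m x) =
      (if j = k then 1 / 6 else 0) *
        (mvfderiv I S x (F m x) - 1 / 4 * mvfderiv I N x (F m x)) +
        1 / 4 * mvfderiv I (Q j k) x (F m x) := by
    rw [mvfderiv_congr hU (hric' j k) hx,
      mvfderiv_add_apply (((SmoothFun.const _).mul hSN').mdiff hx)
        (((SmoothFun.const (1 / 4)).mul (hQs j k)).mdiff hx),
      mvfderiv_const_mul_apply _ ((hQs j k).mdiff hx),
      mvfderiv_const_mul_apply _ (hSN'.mdiff hx),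
      mvfderiv_sub_apply (hSs.mdiff hx) (((SmoothFun.const (1 / 4)).mul hNs).mdiff hx),
      mvfderiv_const_mul_apply _ (hNs.mdiff hx)]
  have key (m) : mvfderiv I S x (F m x) = 0 := by
    have hB := contracted_bianchi hF hx h0 m
    simp only [hdric, Finset.sum_add_distrib, ← Finset.mul_sum, hdQ, hdN] at hB
    simp only [ite_mul, zero_mul, Finset.sum_ite_eq, Finset.mem_univ, if_true] at hB
    have hth : theta I T x (F m x) = - ∑ k, ∑ p, ∑ q, τ m p q x * t k k p q := by
      simp only [theta, codiff, ← hb, covDerivForm_frame_parallel hF hT hx h0, neg_mul,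
        Finset.sum_neg_distrib, Finset.sum_mul]
      congr 1
      conv_rhs => rw [Finset.sum_comm]
      conv_rhs => enter [2, p]; rw [Finset.sum_comm]
      exact Finset.sum_congr rfl fun p _ ↦ Finset.sum_congr rfl fun q _ ↦
        Finset.sum_congr rfl fun k _ ↦ mul_comm _ _
    have hTh : bigTheta I T x (F m x) = ∑ a, ∑ b, ∑ c, τ a b c x * t m a b c
        - 3 * ∑ a, ∑ b, ∑ c, τ a b c x * t a m b c := by
      simp only [bigTheta, ← hb, extDeriv_frame hF hT hx h0]
      exact bigTheta_frame (τ := fun a b c ↦ τ a b c x) (t := t) (fun a b c ↦ form_swap_left _ _ _)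
        (fun a b c ↦ form_rotate _ _ _) m
    have := hθ x (F m x)
    rw [hth, hTh] at this
    linarith
  ext v
  rw [hF.expand hx v, map_sum]
  simp [key]

/-- A function with vanishing differential on a connected manifold without boundary is constant. -/
theorem exists_eq_const_of_mvfderiv_eq_zero [I.Boundaryless] [PreconnectedSpace M]
    (hf : ∀ x, MDiffAt f x) (h : ∀ x, mvfderiv I f x = 0) : ∃ c, ∀ x, f x = c := by
  have hloc : IsLocallyConstant f := by
    rw [IsLocallyConstant.iff_eventually_eq]
    intro x
    set φ := extChartAt I x
    have ht : IsOpen φ.target := isOpen_extChartAt_target x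
    obtain ⟨r, hr, hball⟩ := Metric.isOpen_iff.1 ht (φ x) (mem_extChartAt_target x)
    have hd : ∀ z ∈ Metric.ball (φ x) r, HasFDerivAt (f ∘ φ.symm) (0 : E →L[ℝ] ℝ) z := by
      intro z hz
      have h1 : MDifferentiableAt 𝓘(ℝ, E) I φ.symm z :=
        ((contMDiffOn_extChartAt_symm (n := ∞) x).contMDiffAt (ht.mem_nhds (hball hz))
          ).mdifferentiableAt (by simp)
      have h2 := (hf (φ.symm z)).hasMFDerivAt
      have h3 : mfderiv I 𝓘(ℝ, ℝ) f (φ.symm z) = 0 := by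
        ext v
        exact congrArg (fun L ↦ L v) (h (φ.symm z))
      rw [h3] at h2
      have h4 := (HasMFDerivAt.comp z h2 h1.hasMFDerivAt).hasFDerivAt
      rw [ContinuousLinearMap.zero_comp] at h4
      exact h4
    have hcont := (continuousAt_extChartAt (I := I) x).preimage_mem_nhds (Metric.ball_mem_nhds _ hr)
    filter_upwards [hcont, extChartAt_source_mem_nhds (I := I) x] with y hy hys
    have hc := (convex_ball (φ x) r).is_const_of_fderivWithin_eq_zero (𝕜 := ℝ) (f := f ∘ φ.symm)
      (fun z hz ↦ (hd z hz).differentiableAt.differentiableWithinAt)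
      (fun z hz ↦ by
        rw [fderivWithin_of_isOpen Metric.isOpen_ball hz, (hd z hz).fderiv]) hy
      (Metric.mem_ball_self hr)
    rw [Function.comp_apply, Function.comp_apply, φ.left_inv hys, extChartAt_to_inv] at hc
    exact hc
  rcases isEmpty_or_nonempty M with hM | ⟨⟨x₀⟩⟩
  · exact ⟨0, fun x ↦ (hM.false x).elim⟩
  · exact ⟨f x₀, fun x ↦ hloc.apply_eq_of_preconnectedSpace x x₀⟩

end

end TorsionGeometry

theorem mainTheorem6 {M : Type*} [TopologicalSpace M] [T2Space M] [PreconnectedSpace M]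
    [ChartedSpace (EuclideanSpace ℝ (Fin 6)) M] [IsManifold (𝓡 6) ∞ M]
    [RiemannianBundle (fun x : M ↦ TangentSpace (𝓡 6) x)]
    [IsContMDiffRiemannianBundle (𝓡 6) ∞ (EuclideanSpace ℝ (Fin 6))
      (fun x : M ↦ TangentSpace (𝓡 6) x)]
    (T : Π x : M, TangentSpace (𝓡 6) x [⋀^Fin 3]→L[ℝ] ℝ) (hT : TorsionGeometry.IsSmoothForm (𝓡 6) T) :
    (TorsionGeometry.IsHarmonic (𝓡 6) T →
      ∀ (x : M) (u : TangentSpace (𝓡 6) x),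
        3 * TorsionGeometry.theta (𝓡 6) T x u +
          TorsionGeometry.bigTheta (𝓡 6) T x u = 0) ∧
    ((∀ (x : M) (u : TangentSpace (𝓡 6) x),
        3 * TorsionGeometry.theta (𝓡 6) T x u +
          TorsionGeometry.bigTheta (𝓡 6) T x u = 0) →
      TorsionGeometry.IsNablaEinstein (𝓡 6) (TorsionGeometry.torsionConnection (𝓡 6) T) →
      ∃ c : ℝ, ∀ x : M,
        TorsionGeometry.scalarCurvature (𝓡 6) (TorsionGeometry.leviCivita (𝓡 6) (M := M)) x = c) := by
  refine ⟨fun ⟨hd, hδ⟩ x u ↦ by simp [TorsionGeometry.theta, TorsionGeometry.bigTheta, hd, hδ],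
    fun hθ hE ↦ TorsionGeometry.exists_eq_const_of_mvfderiv_eq_zero
      TorsionGeometry.mdifferentiableAt_scalarCurvature_leviCivita
      (TorsionGeometry.mvfderiv_scalarCurvature_eq_zero (by simp) hT hθ hE)⟩
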